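/- Let $d\ge 1$, $\alpha\in\mathbb R$, $0<\delta<1$. For $U=(\tau,v,\eta,\zeta)\in\mathbb R\times\mathbb R\times\mathbb R^d\times\mathbb R^d$ put $$G_{\alpha,\delta}=\{U:\ \delta\le\tau\pm(v-\alpha)\le 1/\delta\},\qquad M=\{U:\ \tau v=\eta\cdot\zeta,\ \tau^2+v^2+|\eta|^2+|\zeta|^2=1\},$$ $$CM=\{U:\ \tau^2+v^2+|\eta|^2+|\zeta|^2+2|\tau v-\eta\cdot\zeta|\le 1\}.$$ A global generalized solution of the augmented system $$\partial_t\tau+v\partial_s\tau=\tau\partial_s v,\quad \partial_t v+v\partial_s v=\tau\partial_s\tau,\quad \partial_t\eta+v\partial_s\eta=-\tau\partial_s\zeta,\quad \partial_t\zeta+v\partial_s\zeta=-\tau\partial_s\eta$$ is a function $U=(\tau,v,\eta,\zeta)(t,s)$ on $\mathbb R^2$, measurable in $s$ for every $t$, for which there is a locally Lipschitz $\xi:\mathbb R^2\to\mathbb R$ with $\xi(0,0)=0$, such that each $\xi(t,\cdot)$ is a bi-Lipschitz homeomorphism of $\mathbb R$ and, for every $t$ and almost every $y$, $$\partial_y\xi(t,y)=\tau(t,\xi(t,y)),\qquad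 (\partial_t\xi\pm\partial_y\xi)(t,y)=(v\pm\tau)(0,\xi(0,y\pm t)),$$ $$(v\pm\tau)(t,\xi(t,y))=(v\pm\tau)(0,\xi(0,y\pm t)),\qquad (\eta\mp\zeta)(t,\xi(t,y))=(\eta\mp\zeta)(0,\xi(0,y\pm t)).$$ It is valued in a set $S$ if, for every $t$, $U(t,s)\in S$ for almost every $s$. Let $\Sigma_{\alpha,\delta}$ be the set of global generalized solutions valued in $M\cap G_{\alpha,\delta}$ (global relativistic strings). Let $T(\tau,v,\eta,\zeta)=(h,q,Y,Z)=\frac1\tau(1,v,\eta,\zeta)$. Then, for every global generalized solution $U$ valued in $CM\cap G_{\alpha,\delta}$, $TU$ defines a unique element of $C^0(\mathbb R;L^\infty_{weak^*}(\mathbb R;\mathbb R^{1+1+d+d}))$, where this space carries the topology of uniform convergence on compact time intervals. The set $T(\Sigma_{\alpha,\delta})$ is relatively compact in this space, and its closure is exactly the set of all $TU$, where $U$ is a global generalized solution valued in $CM\cap G_{\alpha,\delta}$. -/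

import Mathlib

open MeasureTheory Set
open scoped ENNReal InnerProductSpace

noncomputable section

namespace RelString

/-- The state space `ℝ^{1+1+d+d}`; a point is `U = (τ, v, η, ζ)` (or, after the change of
variables, `u = (h, q, Y, Z)`). -/
abbrev State (d : ℕ) : Type :=
  ℝ × ℝ × EuclideanSpace ℝ (Fin d) × EuclideanSpace ℝ (Fin d)

namespace State

variable {d : ℕ}

/-- The component `τ` of `U = (τ, v, η, ζ)`. -/
def tau (U : State d) : ℝ := U.1

/-- The component `v` of `U = (τ, v, η, ζ)`. -/
def vel (U : State d) : ℝ := U.2.1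

/-- The component `η` of `U = (τ, v, η, ζ)`. -/
def eta (U : State d) : EuclideanSpace ℝ (Fin d) := U.2.2.1

/-- The component `ζ` of `U = (τ, v, η, ζ)`. -/
def zeta (U : State d) : EuclideanSpace ℝ (Fin d) := U.2.2.2

end State

open State

/-- The invariant set `G_{α,δ} = {δ ≤ τ ± (v - α) ≤ 1/δ}`. -/
def setG (d : ℕ) (α δ : ℝ) : Set (State d) :=
  {U | (δ ≤ tau U + (vel U - α) ∧ tau U + (vel U - α) ≤ 1 / δ) ∧
       (δ ≤ tau U - (vel U - α) ∧ tau U - (vel U - α) ≤ 1 / δ)}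

/-- The relativistic constraint `M = {τ v = η · ζ, τ² + v² + |η|² + |ζ|² = 1}`. -/
def setM (d : ℕ) : Set (State d) :=
  {U | tau U * vel U = ⟪eta U, zeta U⟫_ℝ ∧
       tau U ^ 2 + vel U ^ 2 + ‖eta U‖ ^ 2 + ‖zeta U‖ ^ 2 = 1}

/-- The subrelativistic set
`CM = {τ² + v² + |η|² + |ζ|² + 2 |τ v - η · ζ| ≤ 1}`. -/
def setCM (d : ℕ) : Set (State d) :=
  {U | tau U ^ 2 + vel U ^ 2 + ‖eta U‖ ^ 2 + ‖zeta U‖ ^ 2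
        + 2 * |tau U * vel U - ⟪eta U, zeta U⟫_ℝ| ≤ 1}

variable {d : ℕ}

/-- `ξ` is the change of variable `s = ξ(t, y)` attached to `U(t, s) = (τ, v, η, ζ)(t, s)`:
it is locally Lipschitz, `ξ(0,0) = 0`, each `ξ(t, ·)` is a bi-Lipschitz homeomorphism of the
line with `∂_y ξ(t, y) = τ(t, ξ(t, y))`, and d'Alembert's formula
`(∂_t ξ ± ∂_y ξ)(t, y) = (v ± τ)(0, ξ(0, y ± t))` holds. -/
structure IsStringFlow (U : ℝ → ℝ → State d) (ξ : ℝ → ℝ → ℝ) : Prop where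
  normalized : ξ 0 0 = 0
  locallyLipschitz : LocallyLipschitz (fun p : ℝ × ℝ => ξ p.1 p.2)
  lipschitz : ∀ t, ∃ K, LipschitzWith K (ξ t)
  antilipschitz : ∀ t, ∃ K, AntilipschitzWith K (ξ t)
  bijective : ∀ t, Function.Bijective (ξ t)
  deriv_y : ∀ t, ∀ᵐ y : ℝ, HasDerivAt (fun y' => ξ t y') (tau (U t (ξ t y))) y
  dAlembert : ∀ t, ∀ᵐ y : ℝ, ∃ a b : ℝ,
    HasDerivAt (fun t' => ξ t' y) a t ∧ HasDerivAt (fun y' => ξ t y') b y ∧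
    a + b = vel (U 0 (ξ 0 (y + t))) + tau (U 0 (ξ 0 (y + t))) ∧
    a - b = vel (U 0 (ξ 0 (y - t))) - tau (U 0 (ξ 0 (y - t)))

/-- Global generalized solutions of the augmented system
`τ_t + v τ_s = τ v_s`, `v_t + v v_s = τ τ_s`, `η_t + v η_s = -τ ζ_s`, `ζ_t + v ζ_s = -τ η_s`,
given by d'Alembert's formula:
`(v ± τ)(t, ξ(t, y)) = (v ± τ)(0, ξ(0, y ± t))` and
`(η ∓ ζ)(t, ξ(t, y)) = (η ∓ ζ)(0, ξ(0, y ± t))`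
for every time `t` and almost every `y`. -/
def IsGeneralizedSolution (U : ℝ → ℝ → State d) : Prop :=
  (∀ t, AEStronglyMeasurable (U t) volume) ∧
  ∃ ξ : ℝ → ℝ → ℝ, IsStringFlow U ξ ∧
    ∀ t, ∀ᵐ y : ℝ,
      (vel (U t (ξ t y)) + tau (U t (ξ t y))
        = vel (U 0 (ξ 0 (y + t))) + tau (U 0 (ξ 0 (y + t)))) ∧
      (vel (U t (ξ t y)) - tau (U t (ξ t y))
        = vel (U 0 (ξ 0 (y - t))) - tau (U 0 (ξ 0 (y - t)))) ∧
      (eta (U t (ξ t y)) - zeta (U t (ξ t y))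
        = eta (U 0 (ξ 0 (y + t))) - zeta (U 0 (ξ 0 (y + t)))) ∧
      (eta (U t (ξ t y)) + zeta (U t (ξ t y))
        = eta (U 0 (ξ 0 (y - t))) + zeta (U 0 (ξ 0 (y - t))))

/-- At every time, `U(t, ·)` takes its values almost everywhere in `S`. -/
def ValuedIn (U : ℝ → ℝ → State d) (S : Set (State d)) : Prop :=
  ∀ t, ∀ᵐ s : ℝ, U t s ∈ S

/-- The transform `T (τ, v, η, ζ) = (h, q, Y, Z) = (1, v, η, ζ) / τ`. -/
def transformT (U : State d) : State d :=
  (tau U)⁻¹ • ((1, vel U, eta U, zeta U) : State d)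

/-- The Euclidean scalar product of `ℝ^{1+1+d+d}`, as a continuous bilinear map. -/
def dotCLM (d : ℕ) : State d →L[ℝ] State d →L[ℝ] ℝ :=
  let p₁ : State d →L[ℝ] ℝ := ContinuousLinearMap.fst ℝ _ _
  let r₁ := ContinuousLinearMap.snd ℝ ℝ (ℝ × EuclideanSpace ℝ (Fin d) × EuclideanSpace ℝ (Fin d))
  let p₂ : State d →L[ℝ] ℝ := (ContinuousLinearMap.fst ℝ _ _).comp r₁
  let r₂ := (ContinuousLinearMap.snd ℝ ℝ
    (EuclideanSpace ℝ (Fin d) × EuclideanSpace ℝ (Fin d))).comp r₁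
  let p₃ : State d →L[ℝ] EuclideanSpace ℝ (Fin d) := (ContinuousLinearMap.fst ℝ _ _).comp r₂
  let p₄ : State d →L[ℝ] EuclideanSpace ℝ (Fin d) := (ContinuousLinearMap.snd ℝ _ _).comp r₂
  let ip : EuclideanSpace ℝ (Fin d) →L[ℝ] EuclideanSpace ℝ (Fin d) →L[ℝ] ℝ := innerSL ℝ
  (ContinuousLinearMap.mul ℝ ℝ).bilinearComp p₁ p₁
    + (ContinuousLinearMap.mul ℝ ℝ).bilinearComp p₂ p₂
    + ip.bilinearComp p₃ p₃
    + ip.bilinearComp p₄ p₄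

theorem dotCLM_apply (x y : State d) :
    dotCLM d x y = tau x * tau y + vel x * vel y + ⟪eta x, eta y⟫_ℝ + ⟪zeta x, zeta y⟫_ℝ :=
  rfl

/-- The duality pairing `(f, g) ↦ ∫ f(s) · g(s) ds` between `L^∞(ℝ; ℝ^{1+1+d+d})` and
`L^1(ℝ; ℝ^{1+1+d+d})`. -/
def pairing (d : ℕ) :
    Lp (State d) ∞ (volume : Measure ℝ) →ₗ[ℝ] Lp (State d) 1 (volume : Measure ℝ) →ₗ[ℝ] ℝ :=
  ContinuousLinearMap.toLinearMap₁₂ ((dotCLM d).lpPairing volume ∞ 1)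

theorem pairing_apply (f : Lp (State d) ∞ (volume : Measure ℝ))
    (g : Lp (State d) 1 (volume : Measure ℝ)) :
    pairing d f g = ∫ s, dotCLM d (f s) (g s) :=
  (dotCLM d).lpPairing_eq_integral f g

/-- The space `L^∞(ℝ; ℝ^{1+1+d+d})` with its weak-* topology, the coarsest one that makes
`f ↦ ∫ f(s) · g(s) ds` continuous for all `g ∈ L^1(ℝ; ℝ^{1+1+d+d})`. -/
abbrev LinftyWeakStar (d : ℕ) : Type := WeakBilin (pairing d)

/-- A representative of an element of `L^∞(ℝ; ℝ^{1+1+d+d})`. -/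
def LinftyWeakStar.rep (f : LinftyWeakStar d) : ℝ → State d :=
  let F : Lp (State d) ∞ (volume : Measure ℝ) := f
  F

/-- The curve `u` in `C⁰(ℝ; L^∞ weak-*)` is `T U`: for every `t`, `u(t) = T(U(t, ·))` almost
everywhere. -/
def IsTransformOf (u : C(ℝ, LinftyWeakStar d)) (U : ℝ → ℝ → State d) : Prop :=
  ∀ t, (u t).rep =ᵐ[volume] fun s => transformT (U t s)

/-- The set of all `T U`, where `U` is a global generalized solution of the augmented system
valued in `S`. It lies in `C⁰(ℝ; L^∞ weak-*)`, the space `C(ℝ, LinftyWeakStar d)` with the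
compact-open topology (uniform convergence on compact time intervals). -/
def transformedSolutions (S : Set (State d)) : Set C(ℝ, LinftyWeakStar d) :=
  {u | ∃ U : ℝ → ℝ → State d, IsGeneralizedSolution U ∧ ValuedIn U S ∧ IsTransformOf u U}

end RelString

end

noncomputable section

namespace RelString

open Filter Topology State
open scoped NNReal

/-! ### Lipschitz functions of a real variable -/

/-! In the characteristic variables `(v + τ, η - ζ)` and `(v - τ, η + ζ)` of `ℝ^{1+d}` everything
decouples. The set `CM ∩ G` becomes a product of two slabs of the unit ball, and `M ∩ G` the product
of the corresponding slabs of the unit sphere. In the coordinate `y` the system is a linear wave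
equation, so a solution is a superposition of `f' (y + t)` and `g' (y - t)`, and `ξ` is the first
component of the superposition of `f` and `g` (`flow_eq_of_dAlembert`, `exists_wavePair`). Solutions
valued in `CM ∩ G` therefore correspond to pairs `(f, g)` vanishing at `0` with slopes in the ball
slabs, and these pairs are compact for pointwise convergence.

The nonlinear map `T` is compatible with this weak topology: `TU(t, ·)` is the `s`-derivative of
`(y, ∫ v, ∫ η, ∫ ζ)` read at `y = ξ(t, ·)⁻¹(s)`. The increments of `ξ(t, ·)` are at least `δ` times
those of `y`, so this potential depends continuously on `(f, g, t)`; with the bound `‖TU‖ ≤ 1/δ`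
this gives weak-* continuity. The transforms of solutions valued in `CM ∩ G` thus form a continuous
image of a compact space, closed because the target is Hausdorff.

For density, a derivative valued in a ball slab is pushed along a fixed direction `(0, e)`,
alternately forwards and backwards, until it meets the sphere; the first coordinate, hence the slab,
is unchanged. If the displacement has zero mean on cells of length `ε`, the primitives move by
`O(ε)`. -/

theorem ae_of_ae_comp {φ : ℝ → ℝ} {K : ℝ≥0} (hφ : LipschitzWith K φ)
    (hs : Function.Surjective φ) {p : ℝ → Prop} (h : ∀ᵐ y, p (φ y)) : ∀ᵐ s, p s := by
  rw [ae_iff] at h ⊢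
  have hsub : {s | ¬ p s} ⊆ φ '' {y | ¬ p (φ y)} := by
    intro s hps
    obtain ⟨y, rfl⟩ := hs s
    exact ⟨y, hps, rfl⟩
  refine measure_mono_null hsub ?_
  have := hφ.hausdorffMeasure_image_le (d := 1) zero_le_one {y | ¬ p (φ y)}
  rw [hausdorffMeasure_real, h] at this
  simpa using this

/-- Lebesgue measure on the line is one-dimensional Hausdorff measure, which an antilipschitz
preimage enlarges by at most a constant factor. -/
theorem ae_comp_of_ae {φ : ℝ → ℝ} {K : ℝ≥0} (hφ : AntilipschitzWith K φ)
    {p : ℝ → Prop} (h : ∀ᵐ s, p s) : ∀ᵐ y, p (φ y) := by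
  rw [ae_iff] at h ⊢
  have := hφ.hausdorffMeasure_preimage_le (d := 1) zero_le_one {s | ¬ p s}
  rw [hausdorffMeasure_real, h] at this
  simpa using this

theorem ae_comp_add {p : ℝ → Prop} (h : ∀ᵐ s, p s) (t : ℝ) : ∀ᵐ y, p (y + t) :=
  (measurePreserving_add_right volume t).quasiMeasurePreserving.ae h

theorem ae_comp_sub {p : ℝ → Prop} (h : ∀ᵐ s, p s) (t : ℝ) : ∀ᵐ y, p (y - t) :=
  (measurePreserving_sub_right volume t).quasiMeasurePreserving.ae h

theorem quasiMeasurePreserving_of_antilipschitz {φ : ℝ → ℝ} {K : ℝ≥0} (hc : Measurable φ)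
    (hφ : AntilipschitzWith K φ) : Measure.QuasiMeasurePreserving φ volume volume := by
  refine ⟨hc, Measure.AbsolutelyContinuous.mk fun s hs h0 => ?_⟩
  rw [Measure.map_apply hc hs]
  have := ae_comp_of_ae hφ (p := fun y => y ∉ s) (by rw [ae_iff]; simpa using h0)
  rw [ae_iff] at this
  simp only [not_not] at this
  exact this

section Primitive

variable {F : Type*} [NormedAddCommGroup F]

theorem eq_of_ae_hasDerivAt_zero [NormedSpace ℝ F] {f : ℝ → F} {K : ℝ≥0} (hf : LipschitzWith K f)
    (h : ∀ᵐ x, HasDerivAt f 0 x) (x y : ℝ) : f x = f y := by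
  obtain ⟨C, hC⟩ := AbsolutelyContinuousOnInterval.const_of_ae_hasDerivAt_zero
    ((hf.lipschitzOnWith (s := uIcc x y)).absolutelyContinuousOnInterval)
    (h.mono fun x hx _ => hx)
  rw [hC x left_mem_uIcc, hC y right_mem_uIcc]

theorem locallyIntegrable_of_ae_bound {W : ℝ → F} {C : ℝ} (hW : AEStronglyMeasurable W volume)
    (hC : ∀ᵐ y, ‖W y‖ ≤ C) : LocallyIntegrable W volume := by
  refine (locallyIntegrable_const C).mono hW ?_
  filter_upwards [hC] with y hy
  exact hy.trans (le_abs_self C)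

theorem intervalIntegrable_of_ae_bound {W : ℝ → F} {C : ℝ} (hW : AEStronglyMeasurable W volume)
    (hC : ∀ᵐ y, ‖W y‖ ≤ C) (a b : ℝ) : IntervalIntegrable W volume a b :=
  ((locallyIntegrable_of_ae_bound hW hC).integrableOn_isCompact isCompact_uIcc).intervalIntegrable

variable [NormedSpace ℝ F]

theorem lipschitzWith_primitive {W : ℝ → F} {C : ℝ≥0} (hW : AEStronglyMeasurable W volume)
    (hC : ∀ᵐ y, ‖W y‖ ≤ C) (a : ℝ) : LipschitzWith C (fun x => ∫ s in a..x, W s) := by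
  refine LipschitzWith.of_dist_le_mul fun x y => ?_
  rw [dist_eq_norm, intervalIntegral.integral_interval_sub_left
    (intervalIntegrable_of_ae_bound hW hC _ _) (intervalIntegrable_of_ae_bound hW hC _ _),
    Real.dist_eq]
  exact intervalIntegral.norm_integral_le_of_norm_le_const_ae (hC.mono fun z hz _ => hz)

variable [CompleteSpace F]

theorem integral_eq_sub_of_ae_hasDerivAt {f W : ℝ → F} {K : ℝ≥0} {C : ℝ}
    (hf : LipschitzWith K f) (hW : AEStronglyMeasurable W volume) (hC : ∀ᵐ y, ‖W y‖ ≤ C)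
    (h : ∀ᵐ x, HasDerivAt f (W x) x) (a b : ℝ) : ∫ s in a..b, W s = f b - f a := by
  have hC' : ∀ᵐ y, ‖W y‖ ≤ (C.toNNReal : ℝ) := hC.mono fun y hy => hy.trans (Real.le_coe_toNNReal C)
  have hl := hf.sub (lipschitzWith_primitive hW hC' a)
  have := eq_of_ae_hasDerivAt_zero hl (by
    filter_upwards [h, LocallyIntegrable.ae_hasDerivAt_integral
      (locallyIntegrable_of_ae_bound hW hC)] with x h1 h2
    have h3 := h1.sub (h2 a)
    rwa [sub_self] at h3) a b
  simp only [intervalIntegral.integral_same, sub_zero] at this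
  rw [this]; abel

end Primitive

/-! ### Functions with prescribed slopes -/

section Slopes

variable {V : Type*} [NormedAddCommGroup V] [NormedSpace ℝ V]

/-- The functions of a real variable that vanish at `0` and all of whose slopes belong to `K`. -/
def slopeSet (K : Set V) : Set (ℝ → V) :=
  {f | f 0 = 0 ∧ ∀ x y, x < y → (y - x)⁻¹ • (f y - f x) ∈ K}

/-- For pointwise convergence the slope conditions are closed. The slope between `0` and `y` forces
`f y ∈ y • K`, so Tychonoff's theorem applies. -/
theorem isCompact_slopeSet {K : Set V} (hK : IsCompact K) : IsCompact (slopeSet K) := by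
  have hc : IsClosed (slopeSet K) := by
    have : slopeSet K = {f | f 0 = 0} ∩ ⋂ (x : ℝ) (y : ℝ) (_ : x < y),
        {f | (y - x)⁻¹ • (f y - f x) ∈ K} := by
      ext f; simp [slopeSet]
    rw [this]
    refine (isClosed_eq (continuous_apply 0) continuous_const).inter ?_
    refine isClosed_iInter fun x => isClosed_iInter fun y => isClosed_iInter fun _ => ?_
    exact hK.isClosed.preimage (by fun_prop)
  refine (isCompact_univ_pi fun y : ℝ => hK.image (continuous_const_smul y)).of_isClosed_subset
    hc ?_
  rintro f ⟨h0, h⟩ y -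
  rcases lt_trichotomy y 0 with hy | rfl | hy
  · refine ⟨_, h y 0 hy, ?_⟩
    have : y * (0 - y)⁻¹ = -1 := by field_simp [hy.ne]; simp
    simp only [smul_smul, this, h0]; simp
  · exact ⟨_, h 0 1 one_pos, by simp [h0]⟩
  · refine ⟨_, h 0 y hy, ?_⟩
    simp only [smul_smul, h0, sub_zero, mul_inv_cancel₀ hy.ne', one_smul]

theorem lipschitzWith_of_mem_slopeSet {K : Set V} {C : ℝ≥0} (hK : ∀ k ∈ K, ‖k‖ ≤ C) {f : ℝ → V}
    (hf : f ∈ slopeSet K) : LipschitzWith C f := by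
  have key : ∀ x y, x < y → dist (f x) (f y) ≤ C * dist x y := by
    intro x y hxy
    have h := hK _ (hf.2 x y hxy)
    have hpos : 0 < y - x := sub_pos.2 hxy
    rw [norm_smul, norm_inv, Real.norm_of_nonneg hpos.le, inv_mul_le_iff₀ hpos] at h
    rw [dist_comm, dist_eq_norm, dist_comm x, Real.dist_eq, abs_of_pos hpos, mul_comm]
    exact h
  refine LipschitzWith.of_dist_le_mul fun x y => ?_
  rcases lt_trichotomy x y with h | rfl | h
  · exact key x y h
  · simp
  · rw [dist_comm, dist_comm x]; exact key y x h

theorem hasDerivAt_mem_of_mem_slopeSet {K : Set V} (hK : IsClosed K) {f : ℝ → V}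
    (hf : f ∈ slopeSet K) {x : ℝ} {f' : V} (h : HasDerivAt f f' x) : f' ∈ K := by
  -- Slopes are controlled for ordered pairs, so the right-hand difference quotients suffice.
  have h1 := (hasDerivAt_iff_tendsto_slope.1 h).mono_left
    (nhdsWithin_mono x (s := Ioi x) (fun y (hy : x < y) => ne_of_gt hy))
  refine hK.mem_of_tendsto h1 ?_
  filter_upwards [self_mem_nhdsWithin] with y hy
  rw [slope_def_module]
  exact hf.2 x y hy

/-- The slopes of a primitive are averages of `W`, and a closed convex set is stable under
averaging. -/
theorem primitive_mem_slopeSet [CompleteSpace V] {K : Set V} {C : ℝ} (hK : IsClosed K)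
    (hconv : Convex ℝ K) (hC : ∀ k ∈ K, ‖k‖ ≤ C)
    {W : ℝ → V} (hW : AEStronglyMeasurable W volume) (h : ∀ᵐ y, W y ∈ K) :
    (fun x => ∫ s in (0 : ℝ)..x, W s) ∈ slopeSet K := by
  have hb : ∀ᵐ y, ‖W y‖ ≤ C := h.mono fun y hy => hC _ hy
  refine ⟨by simp, fun x y hxy => ?_⟩
  have hi := intervalIntegrable_of_ae_bound hW hb
  rw [intervalIntegral.integral_interval_sub_left (hi _ _) (hi _ _),
    intervalIntegral.integral_of_le hxy.le]
  have := hconv.set_average_mem hK (μ := volume) (t := Ioc x y) (f := W) (by simp [hxy])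
    (by simp) (ae_restrict_of_ae h) ((intervalIntegrable_iff_integrableOn_Ioc_of_le hxy.le).1 (hi x y))
  rw [setAverage_eq] at this
  simpa [Measure.real, ENNReal.toReal_ofReal (sub_pos.2 hxy).le] using this

end Slopes

/-! ### Weak-* continuity from the continuity of integrals over intervals -/

section Family

variable {X : Type*} [TopologicalSpace X] {F : Type*} [NormedAddCommGroup F] [NormedSpace ℝ F]
  [CompleteSpace F]

/-- A π-λ induction from half-lines. Countable disjoint unions give a series dominated, uniformly in
`x`, by `C` times the measures of the pieces. -/
theorem continuous_setIntegral_inter_Ioc {Ψ : X → ℝ → F} {C : ℝ}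
    (hm : ∀ x, AEStronglyMeasurable (Ψ x) volume) (hC : ∀ x, ∀ᵐ s, ‖Ψ x s‖ ≤ C)
    (hc : ∀ a b, Continuous fun x => ∫ s in a..b, Ψ x s) {a b : ℝ} (hab : a ≤ b)
    {A : Set ℝ} (hA : MeasurableSet A) : Continuous fun x => ∫ s in A ∩ Ioc a b, Ψ x s := by
  have hint : ∀ x (B : Set ℝ), IntegrableOn (Ψ x) (B ∩ Ioc a b) := fun x B =>
    ((intervalIntegrable_iff_integrableOn_Ioc_of_le hab).1
      (intervalIntegrable_of_ae_bound (hm x) (hC x) a b)).mono_set inter_subset_right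
  induction A, hA using MeasurableSpace.induction_on_inter (borel_eq_generateFrom_Iic ℝ)
    isPiSystem_Iic with
  | empty => simpa using continuous_const
  | basic A hA =>
    obtain ⟨c, rfl⟩ := hA
    have : Iic c ∩ Ioc a b = Ioc a (max a (min c b)) := by
      ext s; simp only [mem_inter_iff, mem_Iic, mem_Ioc, le_max_iff, le_min_iff]
      constructor
      · rintro ⟨h1, h2, h3⟩; exact ⟨h2, Or.inr ⟨h1, h3⟩⟩
      · rintro ⟨h1, h2 | h2⟩
        · exact absurd h1 (not_lt.2 h2)
        · exact ⟨h2.1, h1, h2.2⟩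
    simp only [this]
    simpa only [intervalIntegral.integral_of_le (le_max_left a (min c b))] using
      hc a (max a (min c b))
  | compl A hA ih =>
    have : ∀ x, ∫ s in Aᶜ ∩ Ioc a b, Ψ x s
        = (∫ s in a..b, Ψ x s) - ∫ s in A ∩ Ioc a b, Ψ x s := by
      intro x
      rw [intervalIntegral.integral_of_le hab, eq_sub_iff_add_eq', ← setIntegral_union
        (Disjoint.mono inter_subset_left inter_subset_left disjoint_compl_right)
        (hA.compl.inter measurableSet_Ioc) (hint x _) (hint x _), ← union_inter_distrib_right,
        union_compl_self, univ_inter]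
    simp only [this]
    exact (hc a b).sub ih
  | iUnion f hd hf ih =>
    have hd' : Pairwise (Function.onFun Disjoint fun i => f i ∩ Ioc a b) := fun i j hij =>
      (hd hij).mono inter_subset_left inter_subset_left
    have hmeas : ∀ i, MeasurableSet (f i ∩ Ioc a b) := fun i => (hf i).inter measurableSet_Ioc
    have : ∀ x, ∫ s in (⋃ i, f i) ∩ Ioc a b, Ψ x s = ∑' i, ∫ s in f i ∩ Ioc a b, Ψ x s := by
      intro x
      rw [iUnion_inter, integral_iUnion hmeas hd']
      rw [← iUnion_inter]
      exact hint x _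
    simp only [this]
    have hfin : ∑' i, volume (f i ∩ Ioc a b) ≠ ∞ := by
      rw [← measure_iUnion hd' hmeas, ← iUnion_inter]
      exact ((measure_mono inter_subset_right).trans_lt measure_Ioc_lt_top).ne
    refine continuous_tsum ih ((ENNReal.summable_toReal hfin).mul_left C) fun i x => ?_
    exact norm_setIntegral_le_of_norm_le_const_ae
      ((measure_mono inter_subset_right).trans_lt measure_Ioc_lt_top) (ae_restrict_of_ae (hC x))

theorem continuous_setIntegral_of_continuous_intervalIntegral {Ψ : X → ℝ → F} {C : ℝ}
    (hm : ∀ x, AEStronglyMeasurable (Ψ x) volume) (hC : ∀ x, ∀ᵐ s, ‖Ψ x s‖ ≤ C)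
    (hc : ∀ a b, Continuous fun x => ∫ s in a..b, Ψ x s)
    {A : Set ℝ} (hA : MeasurableSet A) (hfin : volume A < ∞) :
    Continuous fun x => ∫ s in A, Ψ x s := by
  have hd : Pairwise (Function.onFun Disjoint fun n : ℤ => A ∩ Ioc (n : ℝ) (n + 1)) :=
    fun i j hij => (pairwise_disjoint_Ioc_intCast ℝ hij).mono
      inter_subset_right inter_subset_right
  have hmeas : ∀ n : ℤ, MeasurableSet (A ∩ Ioc (n : ℝ) (n + 1)) :=
    fun n => hA.inter measurableSet_Ioc
  have hU : ⋃ n : ℤ, A ∩ Ioc (n : ℝ) (n + 1) = A := by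
    rw [← inter_iUnion, iUnion_Ioc_intCast, inter_univ]
  have hint : ∀ x, IntegrableOn (Ψ x) A := fun x =>
    Measure.integrableOn_of_bounded hfin.ne (hm x) (ae_restrict_of_ae (hC x))
  have : ∀ x, ∫ s in A, Ψ x s = ∑' n : ℤ, ∫ s in A ∩ Ioc (n : ℝ) (n + 1), Ψ x s := by
    intro x
    rw [← integral_iUnion hmeas hd (by rw [hU]; exact hint x), hU]
  simp only [this]
  have hfin' : ∑' n : ℤ, volume (A ∩ Ioc (n : ℝ) (n + 1)) ≠ ∞ := by
    rw [← measure_iUnion hd hmeas, hU]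
    exact hfin.ne
  refine continuous_tsum (fun n => continuous_setIntegral_inter_Ioc hm hC hc (by simp) hA)
    ((ENNReal.summable_toReal hfin').mul_left C) fun n x => ?_
  exact norm_setIntegral_le_of_norm_le_const_ae
    ((measure_mono inter_subset_left).trans_lt hfin) (ae_restrict_of_ae (hC x))

end Family

variable {d : ℕ}

theorem dotCLM_comm (x y : State d) : dotCLM d x y = dotCLM d y x := by
  simp only [dotCLM_apply, real_inner_comm]; ring

theorem pairing_indicatorConstLp (f : Lp (State d) ∞ (volume : Measure ℝ)) {A : Set ℝ}
    (hA : MeasurableSet A) (hfin : volume A ≠ ∞) (c : State d) :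
    pairing d f (indicatorConstLp 1 hA hfin c) = dotCLM d c (∫ s in A, f s) := by
  have hint : IntegrableOn f A := by
    have := (Lp.memLp f).restrict A
    have hfm : IsFiniteMeasure (volume.restrict A) := ⟨by simpa using hfin.lt_top⟩
    exact memLp_one_iff_integrable.1 (this.mono_exponent le_top)
  rw [pairing_apply, ← ContinuousLinearMap.integral_comp_comm _ hint, ← integral_indicator hA]
  refine integral_congr_ae ?_
  filter_upwards [indicatorConstLp_coeFn (p := 1) (hs := hA) (hμs := hfin) (c := c)] with s hs
  rw [hs]
  by_cases h : s ∈ A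
  · simp [h, dotCLM_comm (f s) c]
  · simp [h]

/-- Continuity of integrals over intervals extends to sets of finite measure, then to simple
functions, then to all of `L¹`, because the uniform bound `C` makes the pairings equicontinuous in
`g`. -/
theorem continuous_linftyWeakStar {X : Type*} [TopologicalSpace X]
    (Ψ : X → LinftyWeakStar d) {C : ℝ} (hae : ∀ x, ∀ᵐ s, ‖(Ψ x).rep s‖ ≤ C)
    (hc : ∀ a b, Continuous fun x => ∫ s in a..b, (Ψ x).rep s) :
    Continuous Ψ := by
  refine WeakBilin.continuous_of_continuous_eval _ fun g => ?_
  obtain ⟨Θ, rfl⟩ : ∃ Θ : X → Lp (State d) ∞ (volume : Measure ℝ), Θ = Ψ := ⟨_, rfl⟩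
  change Continuous fun x => pairing d (Θ x) g
  induction g using Lp.induction (hp_ne_top := ENNReal.one_ne_top) with
  | indicatorConst c hA hfin =>
    simp only [Lp.simpleFunc.coe_indicatorConst]
    simp only [pairing_indicatorConstLp]
    exact (dotCLM d c).continuous.comp
      (continuous_setIntegral_of_continuous_intervalIntegral
        (fun x => Lp.aestronglyMeasurable (Θ x)) hae hc hA hfin)
  | add hf hg hdisj h1 h2 =>
    simp only [map_add]
    exact h1.add h2
  | isClosed =>
    have : IsClosed {g : Lp (State d) 1 (volume : Measure ℝ) |
        Continuous fun x => pairing d (Θ x) g} := by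
      set B := (dotCLM d).lpPairing (volume : Measure ℝ) ∞ 1
      refine isClosed_of_closure_subset fun g hg => ?_
      refine continuous_of_uniform_approx_of_continuous fun u hu => ?_
      obtain ⟨ε, hε, hu⟩ := Metric.mem_uniformity_dist.1 hu
      -- A limit as `η → 0` avoids dividing by `‖B‖ * C`, which may vanish.
      obtain ⟨η, hη, hη'⟩ : ∃ η > 0, ‖B‖ * C * η < ε := by
        have : Tendsto (fun η : ℝ => ‖B‖ * C * η) (𝓝[>] 0) (𝓝 0) := by
          have : Tendsto (fun η : ℝ => ‖B‖ * C * η) (𝓝 0) (𝓝 (‖B‖ * C * 0)) :=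
            (continuous_const.mul continuous_id).tendsto 0
          rw [mul_zero] at this
          exact this.mono_left nhdsWithin_le_nhds
        exact ((this.eventually_lt_const hε).and self_mem_nhdsWithin).exists.imp
          fun η h => ⟨h.2, h.1⟩
      obtain ⟨g', hg', hgg⟩ := Metric.mem_closure_iff.1 hg η hη
      refine ⟨_, hg', fun x => hu ?_⟩
      rw [Real.dist_eq]
      have e : pairing d (Θ x) g - pairing d (Θ x) g' = B (Θ x) (g - g') := by
        rw [map_sub]; rfl
      rw [e]
      have hC0 : 0 ≤ C := by
        obtain ⟨s, hs⟩ := (hae x).exists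
        exact (norm_nonneg _).trans hs
      have hC : ‖Θ x‖ ≤ C := by
        rw [Lp.norm_def, eLpNorm_exponent_top]
        exact ENNReal.toReal_le_of_le_ofReal hC0 (eLpNormEssSup_le_of_ae_bound (hae x))
      calc ‖B (Θ x) (g - g')‖ ≤ ‖B‖ * ‖Θ x‖ * ‖g - g'‖ := B.le_opNorm₂ _ _
        _ ≤ ‖B‖ * C * η := by
          rw [dist_eq_norm] at hgg
          gcongr
        _ < ε := hη'
    exact this

theorem pairing_injective : Function.Injective (pairing d) := by
  rw [← LinearMap.ker_eq_bot, LinearMap.ker_eq_bot']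
  intro f hf
  rw [Lp.eq_zero_iff_ae_eq_zero]
  have hint : ∀ A : Set ℝ, MeasurableSet A → volume A < ∞ → IntegrableOn f A := by
    intro A _ hfin
    have := (Lp.memLp f).restrict A
    have hfm : IsFiniteMeasure (volume.restrict A) := ⟨by simpa using hfin⟩
    exact memLp_one_iff_integrable.1 (this.mono_exponent le_top)
  refine ae_eq_zero_of_forall_setIntegral_eq_of_sigmaFinite hint fun A hA hfin => ?_
  have h := pairing_indicatorConstLp f hA hfin.ne (∫ s in A, f s)
  rw [hf, LinearMap.zero_apply, dotCLM_apply] at h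
  generalize (∫ s in A, f s) = c at h
  have h1 := real_inner_self_nonneg (x := eta c)
  have h2 := real_inner_self_nonneg (x := zeta c)
  have h3 := mul_self_nonneg (tau c)
  have h4 := mul_self_nonneg (vel c)
  refine Prod.ext ?_ (Prod.ext ?_ (Prod.ext ?_ ?_))
  · exact mul_self_eq_zero.1 (by linarith : tau c * tau c = 0)
  · exact mul_self_eq_zero.1 (by linarith : vel c * vel c = 0)
  · exact inner_self_eq_zero.1 (by linarith : ⟪eta c, eta c⟫_ℝ = 0)
  · exact inner_self_eq_zero.1 (by linarith : ⟪zeta c, zeta c⟫_ℝ = 0)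

instance : T2Space (LinftyWeakStar d) :=
  (WeakBilin.isEmbedding (B := pairing d) pairing_injective).t2Space

/-! ### Characteristic variables -/

/-- The space `ℝ^{1+d}` of the characteristic variables `(v ± τ, η ∓ ζ)`. -/
abbrev CharState (d : ℕ) : Type := ℝ × EuclideanSpace ℝ (Fin d)

/-- The right characteristic variable `(v + τ, η - ζ)`. -/
def charPlus (U : State d) : CharState d := (vel U + tau U, eta U - zeta U)

/-- The left characteristic variable `(v - τ, η + ζ)`. -/
def charMinus (U : State d) : CharState d := (vel U - tau U, eta U + zeta U)

/-- The state with given characteristic variables. -/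
def ofChar (w : CharState d × CharState d) : State d :=
  ((w.1.1 - w.2.1) / 2, (w.1.1 + w.2.1) / 2, (1 / 2 : ℝ) • (w.1.2 + w.2.2),
    (1 / 2 : ℝ) • (w.2.2 - w.1.2))

@[simp] theorem charPlus_ofChar (w : CharState d × CharState d) : charPlus (ofChar w) = w.1 := by
  refine Prod.ext ?_ ?_
  · simp only [charPlus, ofChar, vel, tau]; ring
  · simp only [charPlus, ofChar, eta, zeta]; module

@[simp] theorem charMinus_ofChar (w : CharState d × CharState d) : charMinus (ofChar w) = w.2 := by
  refine Prod.ext ?_ ?_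
  · simp only [charMinus, ofChar, vel, tau]; ring
  · simp only [charMinus, ofChar, eta, zeta]; module

@[simp] theorem ofChar_charPlus_charMinus (U : State d) :
    ofChar (charPlus U, charMinus U) = U := by
  refine Prod.ext ?_ (Prod.ext ?_ (Prod.ext ?_ ?_))
  · simp only [charPlus, charMinus, ofChar, vel, tau]; ring
  · simp only [charPlus, charMinus, ofChar, vel, tau]; ring
  · simp only [charPlus, charMinus, ofChar, eta, zeta]; module
  · simp only [charPlus, charMinus, ofChar, eta, zeta]; module

/-- `ofChar` as a continuous linear map. -/
def ofCharCLM (d : ℕ) : CharState d × CharState d →L[ℝ] State d :=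
  LinearMap.toContinuousLinearMap
    { toFun := ofChar
      map_add' := fun x y => by
        refine Prod.ext ?_ (Prod.ext ?_ (Prod.ext ?_ ?_))
        · simp only [ofChar, Prod.fst_add, Prod.snd_add]; ring
        · simp only [ofChar, Prod.fst_add, Prod.snd_add]; ring
        · simp only [ofChar, Prod.fst_add, Prod.snd_add]; module
        · simp only [ofChar, Prod.fst_add, Prod.snd_add]; module
      map_smul' := fun c x => by
        refine Prod.ext ?_ (Prod.ext ?_ (Prod.ext ?_ ?_))
        · simp only [ofChar, Prod.smul_fst, Prod.smul_snd, smul_eq_mul, RingHom.id_apply]; ring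
        · simp only [ofChar, Prod.smul_fst, Prod.smul_snd, smul_eq_mul, RingHom.id_apply]; ring
        · simp only [ofChar, Prod.smul_fst, Prod.smul_snd, RingHom.id_apply]; module
        · simp only [ofChar, Prod.smul_fst, Prod.smul_snd, RingHom.id_apply]; module }

theorem continuous_ofChar : Continuous (ofChar : CharState d × CharState d → State d) :=
  (ofCharCLM d).continuous

theorem continuous_charPlus : Continuous (charPlus : State d → CharState d) := by
  unfold charPlus vel tau eta zeta; fun_prop

theorem continuous_charMinus : Continuous (charMinus : State d → CharState d) := by
  unfold charMinus vel tau eta zeta; fun_prop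

/-- The part of the unit ball of `ℝ^{1+d}` whose first coordinate lies in `I`. -/
def ballSlab (d : ℕ) (I : Set ℝ) : Set (CharState d) := {w | w.1 ∈ I ∧ w.1 ^ 2 + ‖w.2‖ ^ 2 ≤ 1}

/-- The part of the unit sphere of `ℝ^{1+d}` whose first coordinate lies in `I`. -/
def sphereSlab (d : ℕ) (I : Set ℝ) : Set (CharState d) :=
  {w | w.1 ∈ I ∧ w.1 ^ 2 + ‖w.2‖ ^ 2 = 1}

/-- The range of `v + τ` in `G_{α,δ}`. -/
def rangePlus (α δ : ℝ) : Set ℝ := Icc (α + δ) (α + 1 / δ)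

/-- The range of `v - τ` in `G_{α,δ}`. -/
def rangeMinus (α δ : ℝ) : Set ℝ := Icc (α - 1 / δ) (α - δ)

theorem norm_sq_charPlus (U : State d) : (charPlus U).1 ^ 2 + ‖(charPlus U).2‖ ^ 2 =
    (tau U ^ 2 + vel U ^ 2 + ‖eta U‖ ^ 2 + ‖zeta U‖ ^ 2)
      + 2 * (tau U * vel U - ⟪eta U, zeta U⟫_ℝ) := by
  simp only [charPlus, norm_sub_sq_real]; ring

theorem norm_sq_charMinus (U : State d) : (charMinus U).1 ^ 2 + ‖(charMinus U).2‖ ^ 2 =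
    (tau U ^ 2 + vel U ^ 2 + ‖eta U‖ ^ 2 + ‖zeta U‖ ^ 2)
      - 2 * (tau U * vel U - ⟪eta U, zeta U⟫_ℝ) := by
  simp only [charMinus, norm_add_sq_real]; ring

theorem mem_setG_iff {α δ : ℝ} {U : State d} :
    U ∈ setG d α δ ↔ (charPlus U).1 ∈ rangePlus α δ ∧ (charMinus U).1 ∈ rangeMinus α δ := by
  simp only [setG, rangePlus, rangeMinus, charPlus, charMinus, mem_ofPred_eq, mem_Icc]
  constructor
  · rintro ⟨⟨h1, h2⟩, h3, h4⟩
    exact ⟨⟨by linarith, by linarith⟩, by linarith, by linarith⟩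
  · rintro ⟨⟨h1, h2⟩, h3, h4⟩
    exact ⟨⟨by linarith, by linarith⟩, by linarith, by linarith⟩

/-- The two squared norms are `|U|² ± 2 (τ v - η · ζ)`, so the absolute value in `CM` says exactly
that both are at most `1`. -/
theorem mem_setCM_inter_setG_iff {α δ : ℝ} {U : State d} :
    U ∈ setCM d ∩ setG d α δ ↔
      charPlus U ∈ ballSlab d (rangePlus α δ) ∧ charMinus U ∈ ballSlab d (rangeMinus α δ) := by
  simp only [mem_inter_iff, mem_setG_iff, ballSlab, mem_ofPred_eq, norm_sq_charPlus,
    norm_sq_charMinus, setCM]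
  generalize tau U * vel U - ⟪eta U, zeta U⟫_ℝ = x
  constructor
  · rintro ⟨h, h1, h2⟩
    have := le_abs_self x
    have := neg_abs_le x
    exact ⟨⟨h1, by linarith⟩, h2, by linarith⟩
  · rintro ⟨⟨h1, h3⟩, h2, h4⟩
    refine ⟨?_, h1, h2⟩
    rcases abs_cases x with ⟨h, -⟩ | ⟨h, -⟩ <;> rw [h] <;> linarith

theorem mem_setM_inter_setG_iff {α δ : ℝ} {U : State d} :
    U ∈ setM d ∩ setG d α δ ↔
      charPlus U ∈ sphereSlab d (rangePlus α δ) ∧ charMinus U ∈ sphereSlab d (rangeMinus α δ) := by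
  simp only [mem_inter_iff, mem_setG_iff, sphereSlab, mem_ofPred_eq, norm_sq_charPlus,
    norm_sq_charMinus, setM]
  constructor
  · rintro ⟨⟨h, h'⟩, h1, h2⟩
    exact ⟨⟨h1, by linarith⟩, h2, by linarith⟩
  · rintro ⟨⟨h1, h3⟩, h2, h4⟩
    exact ⟨⟨by linarith, by linarith⟩, h1, h2⟩

theorem sphereSlab_subset_ballSlab (I : Set ℝ) : sphereSlab d I ⊆ ballSlab d I :=
  fun _ hw => ⟨hw.1, hw.2.le⟩

theorem setM_inter_setG_subset (α δ : ℝ) :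
    setM d ∩ setG d α δ ⊆ setCM d ∩ setG d α δ := fun U hU => by
  rw [mem_setM_inter_setG_iff] at hU
  exact mem_setCM_inter_setG_iff.2
    ⟨sphereSlab_subset_ballSlab _ hU.1, sphereSlab_subset_ballSlab _ hU.2⟩

theorem norm_le_one_of_mem_ballSlab {I : Set ℝ} : ∀ w ∈ ballSlab d I, ‖w‖ ≤ (1 : ℝ≥0) := by
  rintro w ⟨-, hw⟩
  rw [NNReal.coe_one, Prod.norm_def, max_le_iff, Real.norm_eq_abs]
  exact ⟨abs_le_one_iff_mul_self_le_one.2 (by nlinarith [sq_nonneg ‖w.2‖]),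
    by nlinarith [sq_nonneg w.1, norm_nonneg w.2]⟩

theorem isCompact_ballSlab {I : Set ℝ} (hI : IsClosed I) : IsCompact (ballSlab d I) := by
  refine Metric.isCompact_of_isClosed_isBounded ?_ ?_
  · exact (hI.preimage continuous_fst).inter (isClosed_le ((continuous_fst.pow 2).add (continuous_snd.norm.pow 2)) continuous_const)
  · exact (Metric.isBounded_closedBall (x := 0) (r := 1)).subset fun w hw => by
      simpa using norm_le_one_of_mem_ballSlab w hw

theorem convex_ballSlab {I : Set ℝ} (hI : Convex ℝ I) : Convex ℝ (ballSlab d I) := by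
  have h1 : Convex ℝ {w : CharState d | w.1 ∈ I} :=
    hI.linear_preimage (LinearMap.fst ℝ ℝ (EuclideanSpace ℝ (Fin d)))
  have h2 : ConvexOn ℝ univ fun w : CharState d => w.1 ^ 2 + ‖w.2‖ ^ 2 := by
    have ha : ConvexOn ℝ univ fun w : CharState d => w.1 ^ 2 :=
      (even_two.convexOn_pow (𝕜 := ℝ)).comp_linearMap (LinearMap.fst ℝ ℝ (EuclideanSpace ℝ (Fin d)))
    have hb : ConvexOn ℝ univ fun w : CharState d => ‖w.2‖ ^ 2 :=
      ((convexOn_univ_norm (E := EuclideanSpace ℝ (Fin d))).pow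
        (fun _ _ => norm_nonneg _) 2).comp_linearMap
          (LinearMap.snd ℝ ℝ (EuclideanSpace ℝ (Fin d)))
    exact ha.add hb
  have h3 := h2.convex_le 1
  simp only [mem_univ, true_and] at h3
  exact h1.inter h3

theorem norm_transformT_le {α δ : ℝ} (hδ : 0 < δ) {U : State d}
    (hU : U ∈ setCM d ∩ setG d α δ) : ‖transformT U‖ ≤ δ⁻¹ := by
  obtain ⟨h, ⟨h1, h2⟩, h3, h4⟩ := hU
  have hτ : δ ≤ tau U := by linarith
  have hab := abs_nonneg (tau U * vel U - ⟪eta U, zeta U⟫_ℝ)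
  simp only [setCM, mem_ofPred_eq] at h
  have hn : ‖((1, vel U, eta U, zeta U) : State d)‖ ≤ 1 := by
    simp only [Prod.norm_def, max_le_iff, norm_one, le_refl, true_and, Real.norm_eq_abs]
    have e1 := sq_nonneg (tau U)
    have e2 := sq_nonneg (vel U)
    have e3 := sq_nonneg (‖eta U‖)
    have e4 := sq_nonneg (‖zeta U‖)
    exact ⟨(sq_le_one_iff_abs_le_one _).1 (by linarith),
      (sq_le_one_iff₀ (norm_nonneg _)).1 (by linarith),
      (sq_le_one_iff₀ (norm_nonneg _)).1 (by linarith)⟩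
  rw [transformT, norm_smul, norm_inv, Real.norm_of_nonneg (hδ.le.trans hτ)]
  calc (tau U)⁻¹ * _ ≤ δ⁻¹ * 1 := by gcongr
    _ = δ⁻¹ := mul_one _

/-! ### D'Alembert's formula -/

/-- The characteristic primitives `f` of `(v + τ, η - ζ)(0, ξ(0, ·))`. -/
abbrev rightWaves (d : ℕ) (α δ : ℝ) : Set (ℝ → CharState d) :=
  slopeSet (ballSlab d (rangePlus α δ))

/-- The characteristic primitives `g` of `(v - τ, η + ζ)(0, ξ(0, ·))`. -/
abbrev leftWaves (d : ℕ) (α δ : ℝ) : Set (ℝ → CharState d) :=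
  slopeSet (ballSlab d (rangeMinus α δ))

/-- The superposition of a right and a left wave. -/
def superpose (f g : ℝ → CharState d) (t y : ℝ) : State d := ofChar (f (y + t), g (y - t))

/-- The change of variable `ξ(t, y)` given by d'Alembert's formula. -/
def flow (f g : ℝ → CharState d) (t y : ℝ) : ℝ := tau (superpose f g t y)

/-- The inverse of `flow f g t`. -/
def flowInv (f g : ℝ → CharState d) (t s : ℝ) : ℝ := Function.invFun (flow f g t) s

/-- The solution of the augmented system given by d'Alembert's formula. -/
def solution (f g : ℝ → CharState d) (t s : ℝ) : State d :=
  superpose (deriv f) (deriv g) t (flowInv f g t s)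

/-- A primitive of `transformT (solution f g t ·)`. -/
def potential (f g : ℝ → CharState d) (t s : ℝ) : State d :=
  (flowInv f g t s, (superpose f g t (flowInv f g t s)).2)

theorem charPlus_superpose (f g : ℝ → CharState d) (t y : ℝ) :
    charPlus (superpose f g t y) = f (y + t) := charPlus_ofChar _

theorem charMinus_superpose (f g : ℝ → CharState d) (t y : ℝ) :
    charMinus (superpose f g t y) = g (y - t) := charMinus_ofChar _

theorem flow_eq (f g : ℝ → CharState d) (t y : ℝ) :
    flow f g t y = ((f (y + t)).1 - (g (y - t)).1) / 2 := rfl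

theorem hasDerivAt_superpose {f g : ℝ → CharState d} {t y : ℝ} {f' g' : CharState d}
    (hf : HasDerivAt f f' (y + t)) (hg : HasDerivAt g g' (y - t)) :
    HasDerivAt (superpose f g t) (ofChar (f', g')) y :=
  (ofCharCLM d).hasFDerivAt.comp_hasDerivAt y
    ((hf.comp_add_const y t).prodMk (hg.comp_sub_const y t))

theorem hasDerivAt_superpose_time {f g : ℝ → CharState d} {t y : ℝ} {f' g' : CharState d}
    (hf : HasDerivAt f f' (y + t)) (hg : HasDerivAt g g' (y - t)) :
    HasDerivAt (fun t' => superpose f g t' y) (ofChar (f', -g')) t :=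
  (ofCharCLM d).hasFDerivAt.comp_hasDerivAt t
    ((hf.comp_const_add y t).prodMk (hg.comp_const_sub y t))

theorem hasDerivAt_tau {U : ℝ → State d} {U' : State d} {y : ℝ} (h : HasDerivAt U U' y) :
    HasDerivAt (fun y => tau (U y)) (tau U') y :=
  ((ContinuousLinearMap.fst ℝ ℝ (ℝ × EuclideanSpace ℝ (Fin d) × EuclideanSpace ℝ (Fin d))).hasFDerivAt
    (x := U y)).comp_hasDerivAt y h

theorem lipschitzWith_tau : LipschitzWith 1 (tau : State d → ℝ) := LipschitzWith.prod_fst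

section Waves

variable {α δ : ℝ} {f g : ℝ → CharState d}

theorem lipschitzWith_of_mem_rightWaves (hf : f ∈ rightWaves d α δ) : LipschitzWith 1 f :=
  lipschitzWith_of_mem_slopeSet norm_le_one_of_mem_ballSlab hf

theorem lipschitzWith_of_mem_leftWaves (hg : g ∈ leftWaves d α δ) : LipschitzWith 1 g :=
  lipschitzWith_of_mem_slopeSet norm_le_one_of_mem_ballSlab hg

theorem lipschitzWith_superpose {f g : ℝ → CharState d} (hf : LipschitzWith 1 f)
    (hg : LipschitzWith 1 g) :
    LipschitzWith (‖ofCharCLM d‖₊ * 2) (fun p : ℝ × ℝ => superpose f g p.1 p.2) := by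
  have h1 : LipschitzWith 2 (fun p : ℝ × ℝ => f (p.2 + p.1)) := by
    have := hf.comp ((LipschitzWith.prod_snd (α := ℝ) (β := ℝ)).add LipschitzWith.prod_fst)
    rwa [one_mul, one_add_one_eq_two] at this
  have h2 : LipschitzWith 2 (fun p : ℝ × ℝ => g (p.2 - p.1)) := by
    have := hg.comp ((LipschitzWith.prod_snd (α := ℝ) (β := ℝ)).sub LipschitzWith.prod_fst)
    rwa [one_mul, one_add_one_eq_two] at this
  have := (ofCharCLM d).lipschitz.comp (h1.prodMk h2)
  rwa [max_self] at this

theorem lipschitzWith_superpose_space {f g : ℝ → CharState d} (hf : LipschitzWith 1 f)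
    (hg : LipschitzWith 1 g) (t : ℝ) :
    LipschitzWith (‖ofCharCLM d‖₊ * 2) (superpose f g t) := by
  have := (lipschitzWith_superpose hf hg).comp (LipschitzWith.prodMk_left t)
  rwa [mul_one] at this

theorem lipschitzWith_flow {f g : ℝ → CharState d} (hf : LipschitzWith 1 f)
    (hg : LipschitzWith 1 g) (t : ℝ) : LipschitzWith (‖ofCharCLM d‖₊ * 2) (flow f g t) := by
  have := lipschitzWith_tau.comp (lipschitzWith_superpose_space hf hg t)
  rwa [one_mul] at this

/-- The slopes of `f` are at least `α + δ` and those of `g` at most `α - δ` in the first coordinate;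
`α` cancels in the half difference. -/
theorem mul_le_flow_sub (hf : f ∈ rightWaves d α δ) (hg : g ∈ leftWaves d α δ) (t : ℝ)
    {x y : ℝ} (hxy : x < y) : δ * (y - x) ≤ flow f g t y - flow f g t x := by
  have hpos : 0 < y - x := sub_pos.2 hxy
  have h1 := (hf.2 (x + t) (y + t) (by linarith)).1.1
  have h2 := (hg.2 (x - t) (y - t) (by linarith)).1.2
  rw [Prod.smul_fst, Prod.fst_sub, smul_eq_mul, add_sub_add_right_eq_sub,
    le_inv_mul_iff₀ hpos] at h1
  rw [Prod.smul_fst, Prod.fst_sub, smul_eq_mul, sub_sub_sub_cancel_right,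
    inv_mul_le_iff₀ hpos] at h2
  rw [flow_eq, flow_eq]
  linarith

theorem antilipschitzWith_flow (hδ : 0 < δ) (hf : f ∈ rightWaves d α δ)
    (hg : g ∈ leftWaves d α δ) (t : ℝ) : AntilipschitzWith (δ⁻¹).toNNReal (flow f g t) := by
  have key : ∀ x y, x < y → dist x y ≤ δ⁻¹ * dist (flow f g t x) (flow f g t y) := by
    intro x y hxy
    have h := mul_le_flow_sub hf hg t hxy
    have h0 : 0 ≤ δ * (y - x) := mul_nonneg hδ.le (sub_nonneg.2 hxy.le)
    rw [dist_comm, dist_comm (flow f g t x), Real.dist_eq, Real.dist_eq,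
      abs_of_pos (sub_pos.2 hxy), abs_of_nonneg (h0.trans h), le_inv_mul_iff₀ hδ]
    exact h
  refine AntilipschitzWith.of_le_mul_dist fun x y => ?_
  rw [Real.coe_toNNReal _ (inv_nonneg.2 hδ.le)]
  rcases lt_trichotomy x y with h | rfl | h
  · exact key x y h
  · simp
  · rw [dist_comm, dist_comm (flow f g t x)]; exact key y x h

theorem bijective_flow (hδ : 0 < δ) (hf : f ∈ rightWaves d α δ)
    (hg : g ∈ leftWaves d α δ) (t : ℝ) : Function.Bijective (flow f g t) := by
  refine ⟨(antilipschitzWith_flow hδ hf hg t).injective, ?_⟩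
  refine Continuous.surjective (lipschitzWith_flow (lipschitzWith_of_mem_rightWaves hf)
    (lipschitzWith_of_mem_leftWaves hg) t).continuous ?_ ?_
  · have h : Tendsto (fun y => δ * y + flow f g t 0) atTop atTop :=
      tendsto_atTop_add_const_right _ _ (tendsto_id.const_mul_atTop hδ)
    refine tendsto_atTop_mono' _ ?_ h
    filter_upwards [eventually_gt_atTop 0] with y hy
    have := mul_le_flow_sub hf hg t hy
    linarith
  · have h : Tendsto (fun y => δ * y + flow f g t 0) atBot atBot :=
      tendsto_atBot_add_const_right _ _ (tendsto_id.const_mul_atBot hδ)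
    refine tendsto_atBot_mono' _ ?_ h
    filter_upwards [eventually_lt_atBot 0] with y hy
    have := mul_le_flow_sub hf hg t hy
    linarith

variable (hδ : 0 < δ) (hf : f ∈ rightWaves d α δ) (hg : g ∈ leftWaves d α δ)
include hδ hf hg

theorem flow_flowInv (t s : ℝ) : flow f g t (flowInv f g t s) = s :=
  Function.rightInverse_invFun (bijective_flow hδ hf hg t).2 s

theorem flowInv_flow (t y : ℝ) : flowInv f g t (flow f g t y) = y :=
  Function.leftInverse_invFun (bijective_flow hδ hf hg t).1 y

theorem lipschitzWith_flowInv (t : ℝ) : LipschitzWith (δ⁻¹).toNNReal (flowInv f g t) :=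
  (antilipschitzWith_flow hδ hf hg t).to_rightInverse (flow_flowInv hδ hf hg t)

theorem solution_flow (t y : ℝ) :
    solution f g t (flow f g t y) = superpose (deriv f) (deriv g) t y := by
  rw [solution, flowInv_flow hδ hf hg]

end Waves

theorem measurable_solution {α δ : ℝ} {f g : ℝ → CharState d} (hδ : 0 < δ)
    (hf : f ∈ rightWaves d α δ) (hg : g ∈ leftWaves d α δ) (t : ℝ) :
    Measurable (solution f g t) := by
  have h := (lipschitzWith_flowInv hδ hf hg t).continuous.measurable
  exact continuous_ofChar.measurable.comp
    (((measurable_deriv f).comp (h.add_const t)).prodMk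
      ((measurable_deriv g).comp (h.sub_const t)))

theorem measurable_transformT : Measurable (transformT : State d → State d) := by
  have h1 : Measurable (tau : State d → ℝ) := measurable_fst
  have h2 : Measurable (fun U : State d => U.2) := measurable_snd
  exact h1.inv.smul (measurable_const.prodMk h2)

theorem ae_hasDerivAt_of_lipschitzWith {f : ℝ → CharState d} (hf : LipschitzWith 1 f) :
    ∀ᵐ y, HasDerivAt f (deriv f y) y :=
  hf.ae_differentiableAt_real.mono fun _ h => h.hasDerivAt

theorem ae_deriv_mem_of_mem_slopeSet {I : Set ℝ} (hI : IsClosed I) {f : ℝ → CharState d}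
    (hf : f ∈ slopeSet (ballSlab d I)) : ∀ᵐ y, deriv f y ∈ ballSlab d I := by
  filter_upwards [ae_hasDerivAt_of_lipschitzWith
    (lipschitzWith_of_mem_slopeSet norm_le_one_of_mem_ballSlab hf)] with y hy
  exact hasDerivAt_mem_of_mem_slopeSet (isCompact_ballSlab hI).isClosed hf hy

theorem isClosed_rangePlus (α δ : ℝ) : IsClosed (rangePlus α δ) := isClosed_Icc

theorem isClosed_rangeMinus (α δ : ℝ) : IsClosed (rangeMinus α δ) := isClosed_Icc

section Waves

variable {α δ : ℝ} {f g : ℝ → CharState d}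

theorem ae_hasDerivAt_shift (hf : f ∈ rightWaves d α δ) (hg : g ∈ leftWaves d α δ) (t : ℝ) :
    ∀ᵐ y, HasDerivAt f (deriv f (y + t)) (y + t) ∧ HasDerivAt g (deriv g (y - t)) (y - t) :=
  (ae_comp_add (ae_hasDerivAt_of_lipschitzWith (lipschitzWith_of_mem_rightWaves hf)) t).and
    (ae_comp_sub (ae_hasDerivAt_of_lipschitzWith (lipschitzWith_of_mem_leftWaves hg)) t)

theorem ae_superpose_deriv_mem (hf : f ∈ rightWaves d α δ) (hg : g ∈ leftWaves d α δ) (t : ℝ) :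
    ∀ᵐ y, superpose (deriv f) (deriv g) t y ∈ setCM d ∩ setG d α δ := by
  filter_upwards [ae_comp_add (ae_deriv_mem_of_mem_slopeSet (isClosed_rangePlus α δ) hf) t,
    ae_comp_sub (ae_deriv_mem_of_mem_slopeSet (isClosed_rangeMinus α δ) hg) t] with y h1 h2
  rw [mem_setCM_inter_setG_iff, charPlus_superpose, charMinus_superpose]
  exact ⟨h1, h2⟩

theorem ae_of_ae_flow (hδ : 0 < δ) (hf : f ∈ rightWaves d α δ) (hg : g ∈ leftWaves d α δ)
    (t : ℝ) {p : ℝ → Prop} (h : ∀ᵐ y, p (flow f g t y)) : ∀ᵐ s, p s :=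
  ae_of_ae_comp (lipschitzWith_flow (lipschitzWith_of_mem_rightWaves hf)
    (lipschitzWith_of_mem_leftWaves hg) t) (bijective_flow hδ hf hg t).2 h

theorem valuedIn_solution (hδ : 0 < δ) (hf : f ∈ rightWaves d α δ) (hg : g ∈ leftWaves d α δ) :
    ValuedIn (solution f g) (setCM d ∩ setG d α δ) := by
  intro t
  refine ae_of_ae_flow hδ hf hg t ?_
  simp only [solution_flow hδ hf hg]
  exact ae_superpose_deriv_mem hf hg t

theorem valuedIn_solution_of_sphere (hδ : 0 < δ) (hf : f ∈ rightWaves d α δ)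
    (hg : g ∈ leftWaves d α δ) (hf' : ∀ᵐ y, deriv f y ∈ sphereSlab d (rangePlus α δ))
    (hg' : ∀ᵐ y, deriv g y ∈ sphereSlab d (rangeMinus α δ)) :
    ValuedIn (solution f g) (setM d ∩ setG d α δ) := by
  intro t
  refine ae_of_ae_flow hδ hf hg t ?_
  simp only [solution_flow hδ hf hg]
  filter_upwards [ae_comp_add hf' t, ae_comp_sub hg' t] with y h1 h2
  rw [mem_setM_inter_setG_iff, charPlus_superpose, charMinus_superpose]
  exact ⟨h1, h2⟩

theorem isStringFlow_flow (hδ : 0 < δ) (hf : f ∈ rightWaves d α δ) (hg : g ∈ leftWaves d α δ) :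
    IsStringFlow (solution f g) (flow f g) where
  normalized := by simp [flow_eq, hf.1, hg.1]
  locallyLipschitz := (lipschitzWith_tau.comp (lipschitzWith_superpose
    (lipschitzWith_of_mem_rightWaves hf) (lipschitzWith_of_mem_leftWaves hg))).locallyLipschitz
  lipschitz t := ⟨_, lipschitzWith_flow (lipschitzWith_of_mem_rightWaves hf)
    (lipschitzWith_of_mem_leftWaves hg) t⟩
  antilipschitz t := ⟨_, antilipschitzWith_flow hδ hf hg t⟩
  bijective t := bijective_flow hδ hf hg t
  deriv_y t := by
    filter_upwards [ae_hasDerivAt_shift hf hg t] with y hy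
    rw [solution_flow hδ hf hg]
    exact hasDerivAt_tau (hasDerivAt_superpose hy.1 hy.2)
  dAlembert t := by
    filter_upwards [ae_hasDerivAt_shift hf hg t] with y hy
    refine ⟨_, _, hasDerivAt_tau (hasDerivAt_superpose_time hy.1 hy.2),
      hasDerivAt_tau (hasDerivAt_superpose hy.1 hy.2), ?_, ?_⟩
    · simp only [solution_flow hδ hf hg, superpose, add_zero, vel, tau, ofChar,
        Prod.fst_neg]
      ring
    · simp only [solution_flow hδ hf hg, superpose, sub_zero, vel, tau, ofChar,
        Prod.fst_neg]
      ring

theorem isGeneralizedSolution_solution (hδ : 0 < δ) (hf : f ∈ rightWaves d α δ)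
    (hg : g ∈ leftWaves d α δ) : IsGeneralizedSolution (solution f g) := by
  refine ⟨fun t => (measurable_solution hδ hf hg t).aestronglyMeasurable, flow f g,
    isStringFlow_flow hδ hf hg, fun t => Eventually.of_forall fun y => ?_⟩
  have hp : charPlus (solution f g t (flow f g t y))
      = charPlus (solution f g 0 (flow f g 0 (y + t))) := by
    simp only [solution_flow hδ hf hg, charPlus_superpose, add_zero]
  have hm : charMinus (solution f g t (flow f g t y))
      = charMinus (solution f g 0 (flow f g 0 (y - t))) := by
    simp only [solution_flow hδ hf hg, charMinus_superpose, sub_zero]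
  exact ⟨congrArg Prod.fst hp, congrArg Prod.fst hm, congrArg Prod.snd hp, congrArg Prod.snd hm⟩

/-! ### The transform of a solution -/

theorem ae_hasDerivAt_potential (hδ : 0 < δ) (hf : f ∈ rightWaves d α δ)
    (hg : g ∈ leftWaves d α δ) (t : ℝ) :
    ∀ᵐ s, HasDerivAt (potential f g t) (transformT (solution f g t s)) s := by
  refine ae_of_ae_flow hδ hf hg t ?_
  filter_upwards [ae_hasDerivAt_shift hf hg t, ae_superpose_deriv_mem hf hg t] with y hy hmem
  rw [solution_flow hδ hf hg]
  have hτ : 0 < tau (superpose (deriv f) (deriv g) t y) := by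
    obtain ⟨-, ⟨h1, -⟩, h2, -⟩ := hmem
    linarith
  have hsup := hasDerivAt_superpose hy.1 hy.2
  have hinv : HasDerivAt (flowInv f g t) (tau (superpose (deriv f) (deriv g) t y))⁻¹
      (flow f g t y) := by
    -- Differentiability at the single point and continuity of the inverse are enough; the flow is
    -- merely Lipschitz.
    refine HasDerivAt.of_local_left_inverse (f := flow f g t)
      (lipschitzWith_flowInv hδ hf hg t).continuous.continuousAt ?_ hτ.ne'
      (Eventually.of_forall (flow_flowInv hδ hf hg t))
    rw [flowInv_flow hδ hf hg]
    exact hasDerivAt_tau hsup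
  have hcurve : HasDerivAt (fun y => ((y, (superpose f g t y).2) : State d))
      (1, (superpose (deriv f) (deriv g) t y).2) (flowInv f g t (flow f g t y)) := by
    rw [flowInv_flow hδ hf hg]
    exact (hasDerivAt_id y).prodMk
      (((ContinuousLinearMap.snd ℝ ℝ
        (ℝ × EuclideanSpace ℝ (Fin d) × EuclideanSpace ℝ (Fin d))).hasFDerivAt
          (x := superpose f g t y)).comp_hasDerivAt y hsup)
  exact hcurve.scomp (flow f g t y) hinv

theorem lipschitzWith_potential (hδ : 0 < δ) (hf : f ∈ rightWaves d α δ)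
    (hg : g ∈ leftWaves d α δ) (t : ℝ) : ∃ K, LipschitzWith K (potential f g t) :=
  ⟨_, (LipschitzWith.id.prodMk (LipschitzWith.prod_snd.comp (lipschitzWith_superpose_space
    (lipschitzWith_of_mem_rightWaves hf) (lipschitzWith_of_mem_leftWaves hg) t))).comp
      (lipschitzWith_flowInv hδ hf hg t)⟩

theorem ae_norm_transformT_solution_le (hδ : 0 < δ) (hf : f ∈ rightWaves d α δ)
    (hg : g ∈ leftWaves d α δ) (t : ℝ) : ∀ᵐ s, ‖transformT (solution f g t s)‖ ≤ δ⁻¹ :=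
  (valuedIn_solution hδ hf hg t).mono fun _ h => norm_transformT_le hδ h

theorem integral_transformT_solution (hδ : 0 < δ) (hf : f ∈ rightWaves d α δ)
    (hg : g ∈ leftWaves d α δ) (t a b : ℝ) :
    ∫ s in a..b, transformT (solution f g t s) = potential f g t b - potential f g t a := by
  obtain ⟨K, hK⟩ := lipschitzWith_potential hδ hf hg t
  exact integral_eq_sub_of_ae_hasDerivAt hK
    (measurable_transformT.comp (measurable_solution hδ hf hg t)).aestronglyMeasurable
    (ae_norm_transformT_solution_le hδ hf hg t) (ae_hasDerivAt_potential hδ hf hg t) a b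

theorem memLp_transformT_solution (hδ : 0 < δ) (hf : f ∈ rightWaves d α δ)
    (hg : g ∈ leftWaves d α δ) (t : ℝ) :
    MemLp (fun s => transformT (solution f g t s)) ∞ volume :=
  memLp_top_of_bound
    (measurable_transformT.comp (measurable_solution hδ hf hg t)).aestronglyMeasurable _
    (ae_norm_transformT_solution_le hδ hf hg t)

end Waves

/-! ### Dependence on the waves -/

theorem continuous_slopeSet_eval {V : Type*} [NormedAddCommGroup V] [NormedSpace ℝ V] {K : Set V}
    {C : ℝ≥0} (hK : ∀ k ∈ K, ‖k‖ ≤ C) :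
    Continuous fun p : slopeSet K × ℝ => (p.1 : ℝ → V) p.2 :=
  continuous_prod_of_continuous_lipschitzWith' _ C
    (fun f => lipschitzWith_of_mem_slopeSet hK f.2)
    (fun y => (continuous_apply y).comp continuous_subtype_val)

/-- The estimate `|ψ x s - ψ x₀ s| ≤ K |s - φ x (ψ x₀ s)|` involves `φ x` only at a fixed point, so
pointwise continuity in `x` suffices. -/
theorem continuous_rightInverse_of_antilipschitz {X : Type*} [TopologicalSpace X]
    {φ ψ : X → ℝ → ℝ} {K : ℝ≥0} (hφ : ∀ x, AntilipschitzWith K (φ x))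
    (hψ : ∀ x s, φ x (ψ x s) = s) (hc : ∀ y, Continuous fun x => φ x y) (s : ℝ) :
    Continuous fun x => ψ x s := by
  refine continuous_iff_continuousAt.2 fun x₀ => ?_
  refine tendsto_iff_dist_tendsto_zero.2 ?_
  have h1 : Tendsto (fun x => K * dist s (φ x (ψ x₀ s))) (𝓝 x₀) (𝓝 0) := by
    have : Tendsto (fun x => K * dist s (φ x (ψ x₀ s))) (𝓝 x₀)
        (𝓝 (K * dist s (φ x₀ (ψ x₀ s)))) :=
      (continuous_const.mul (continuous_const.dist (hc _))).tendsto x₀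
    simpa [hψ] using this
  refine squeeze_zero (fun _ => dist_nonneg) (fun x => ?_) h1
  have := (hφ x).le_mul_dist (ψ x s) (ψ x₀ s)
  rwa [hψ] at this

/-- The pairs of waves of the solutions valued in `CM ∩ G_{α,δ}`, with the topology of pointwise
convergence. -/
abbrev WavePair (d : ℕ) (α δ : ℝ) : Type := rightWaves d α δ × leftWaves d α δ

section WavePair

variable {α δ : ℝ}

instance : CompactSpace (WavePair d α δ) :=
  have := isCompact_iff_compactSpace.1
    (isCompact_slopeSet (isCompact_ballSlab (d := d) (isClosed_rangePlus α δ)))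
  have := isCompact_iff_compactSpace.1
    (isCompact_slopeSet (isCompact_ballSlab (d := d) (isClosed_rangeMinus α δ)))
  inferInstance

theorem continuous_superpose : Continuous fun p : (WavePair d α δ × ℝ) × ℝ =>
    superpose (p.1.1.1 : ℝ → CharState d) p.1.1.2 p.1.2 p.2 := by
  have h1 : Continuous fun p : (WavePair d α δ × ℝ) × ℝ => (p.1.1.1 : ℝ → CharState d)
      (p.2 + p.1.2) :=
    (continuous_slopeSet_eval norm_le_one_of_mem_ballSlab).comp
      (((continuous_fst.comp continuous_fst).fst).prodMk (by fun_prop))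
  have h2 : Continuous fun p : (WavePair d α δ × ℝ) × ℝ => (p.1.1.2 : ℝ → CharState d)
      (p.2 - p.1.2) :=
    (continuous_slopeSet_eval norm_le_one_of_mem_ballSlab).comp
      (((continuous_fst.comp continuous_fst).snd).prodMk (by fun_prop))
  exact continuous_ofChar.comp (h1.prodMk h2)

theorem continuous_potential (hδ : 0 < δ) (s : ℝ) : Continuous fun p : WavePair d α δ × ℝ =>
    potential (p.1.1 : ℝ → CharState d) p.1.2 p.2 s := by
  have hinv : Continuous fun p : WavePair d α δ × ℝ =>
      flowInv (p.1.1 : ℝ → CharState d) p.1.2 p.2 s := by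
    refine continuous_rightInverse_of_antilipschitz
      (φ := fun p : WavePair d α δ × ℝ => flow (p.1.1 : ℝ → CharState d) p.1.2 p.2)
      (fun p => antilipschitzWith_flow hδ p.1.1.2 p.1.2.2 p.2)
      (fun p s => flow_flowInv hδ p.1.1.2 p.1.2.2 p.2 s) (fun y => ?_) s
    exact lipschitzWith_tau.continuous.comp
      (continuous_superpose.comp (continuous_id.prodMk continuous_const))
  exact hinv.prodMk (continuous_superpose.comp (continuous_id.prodMk hinv)).snd

/-- The transform at time `t` of the solution with given waves. -/
def transformAt (hδ : 0 < δ) (p : WavePair d α δ × ℝ) : LinftyWeakStar d :=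
  (memLp_transformT_solution hδ p.1.1.2 p.1.2.2 p.2).toLp

theorem rep_transformAt (hδ : 0 < δ) (p : WavePair d α δ × ℝ) : (transformAt hδ p).rep =ᵐ[volume]
    fun s => transformT (solution (p.1.1 : ℝ → CharState d) p.1.2 p.2 s) :=
  MemLp.coeFn_toLp _

theorem continuous_transformAt (hδ : 0 < δ) :
    Continuous (transformAt hδ : WavePair d α δ × ℝ → LinftyWeakStar d) := by
  refine continuous_linftyWeakStar (C := δ⁻¹) _ (fun p => ?_) fun a b => ?_
  · filter_upwards [rep_transformAt hδ p,
      ae_norm_transformT_solution_le hδ p.1.1.2 p.1.2.2 p.2] with s h1 h2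
    rwa [h1]
  · have : ∀ p : WavePair d α δ × ℝ, ∫ s in a..b, (transformAt hδ p).rep s
        = potential (p.1.1 : ℝ → CharState d) p.1.2 p.2 b
          - potential (p.1.1 : ℝ → CharState d) p.1.2 p.2 a := by
      intro p
      rw [← integral_transformT_solution hδ p.1.1.2 p.1.2.2]
      exact intervalIntegral.integral_congr_ae
        ((rep_transformAt hδ p).mono fun s hs _ => hs)
    simp only [this]
    exact (continuous_potential hδ b).sub (continuous_potential hδ a)

/-- The curve in `C⁰(ℝ; L^∞ weak-*)` defined by the solution with given waves. -/
def transformCurve (hδ : 0 < δ) (z : WavePair d α δ) : C(ℝ, LinftyWeakStar d) :=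
  ⟨fun t => transformAt hδ (z, t), (continuous_transformAt hδ).comp (by fun_prop)⟩

theorem continuous_transformCurve (hδ : 0 < δ) :
    Continuous (transformCurve hδ : WavePair d α δ → C(ℝ, LinftyWeakStar d)) :=
  ContinuousMap.continuous_of_continuous_uncurry _ (continuous_transformAt hδ)

theorem isTransformOf_transformCurve (hδ : 0 < δ) (z : WavePair d α δ) :
    IsTransformOf (transformCurve hδ z) (solution (z.1 : ℝ → CharState d) z.2) :=
  fun t => rep_transformAt hδ (z, t)

end WavePair

theorem IsTransformOf.unique {u u' : C(ℝ, LinftyWeakStar d)} {U U' : ℝ → ℝ → State d}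
    (hu : IsTransformOf u U) (hu' : IsTransformOf u' U')
    (h : ∀ t, U t =ᵐ[volume] U' t) : u = u' := by
  ext1 t
  refine Lp.ext ?_
  change (u t).rep =ᵐ[volume] (u' t).rep
  filter_upwards [hu t, hu' t, h t] with s h1 h2 h3
  rw [h1, h2, h3]

/-! ### Every solution is given by d'Alembert's formula -/

/-- The difference of `ξ` and the flow has zero derivative in `y` and in `t` for almost every `y`:
it is constant in `y`, then in `t`, and vanishes at the origin. -/
theorem flow_eq_of_dAlembert {ξ : ℝ → ℝ → ℝ} {W₁ W₂ f g : ℝ → CharState d}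
    (hlip : ∀ t, ∃ K, LipschitzWith K (ξ t)) (h0 : ξ 0 0 = 0) (hf0 : f 0 = 0) (hg0 : g 0 = 0)
    (hf : LipschitzWith 1 f) (hg : LipschitzWith 1 g)
    (hf' : ∀ᵐ y, HasDerivAt f (W₁ y) y) (hg' : ∀ᵐ y, HasDerivAt g (W₂ y) y)
    (hξ : ∀ t, ∀ᵐ y : ℝ, ∃ a b : ℝ,
      HasDerivAt (fun t' => ξ t' y) a t ∧ HasDerivAt (fun y' => ξ t y') b y ∧
      a + b = (W₁ (y + t)).1 ∧ a - b = (W₂ (y - t)).1) (t y : ℝ) : ξ t y = flow f g t y := by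
  have hderiv : ∀ t, ∀ᵐ y, HasDerivAt (fun y' => ξ t y' - flow f g t y') 0 y ∧
      HasDerivAt (fun t' => ξ t' y - flow f g t' y) 0 t := by
    intro t
    filter_upwards [hξ t, ae_comp_add hf' t, ae_comp_sub hg' t] with y ⟨a, b, ha, hb, h1, h2⟩ h3 h4
    have e1 := hb.sub (hasDerivAt_tau (hasDerivAt_superpose h3 h4))
    have e2 := ha.sub (hasDerivAt_tau (hasDerivAt_superpose_time h3 h4))
    have z1 : b - tau (ofChar (W₁ (y + t), W₂ (y - t))) = 0 := by
      simp only [tau, ofChar]; linarith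
    have z2 : a - tau (ofChar (W₁ (y + t), -W₂ (y - t))) = 0 := by
      simp only [tau, ofChar, Prod.fst_neg]; linarith
    rw [z1] at e1
    rw [z2] at e2
    exact ⟨e1, e2⟩
  have hspace : ∀ t y, ξ t y - flow f g t y = ξ t 0 - flow f g t 0 := by
    intro t y
    obtain ⟨K, hK⟩ := hlip t
    exact eq_of_ae_hasDerivAt_zero (hK.sub (lipschitzWith_flow hf hg t))
      ((hderiv t).mono fun _ h => h.1) y 0
  have htime : ∀ t, HasDerivAt (fun t' => ξ t' 0 - flow f g t' 0) 0 t := by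
    intro t
    -- The exceptional null set depends on `t`, but the difference does not depend on `y`, so one
    -- good `y` for each `t` is enough.
    obtain ⟨y, -, hy⟩ := (hderiv t).exists
    simpa only [hspace _ y] using hy
  have hconst := is_const_of_deriv_eq_zero (fun t => (htime t).differentiableAt)
    (fun t => (htime t).deriv) t 0
  have h00 : flow f g 0 0 = 0 := by simp [flow_eq, hf0, hg0]
  have := hspace t y
  rw [hconst, h0, h00] at this
  linarith

theorem exists_wavePair {α δ : ℝ} (hδ : 0 < δ) {U : ℝ → ℝ → State d}
    (hU : IsGeneralizedSolution U) (hV : ValuedIn U (setCM d ∩ setG d α δ)) :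
    ∃ z : WavePair d α δ, ∀ t, U t =ᵐ[volume] solution (z.1 : ℝ → CharState d) z.2 t := by
  obtain ⟨hm, ξ, hξ, hchar⟩ := hU
  obtain ⟨K₀, hK₀⟩ := hξ.antilipschitz 0
  obtain ⟨L₀, hL₀⟩ := hξ.lipschitz 0
  have hmeas : AEStronglyMeasurable (fun y => U 0 (ξ 0 y)) volume :=
    (hm 0).comp_quasiMeasurePreserving
      (quasiMeasurePreserving_of_antilipschitz hL₀.continuous.measurable hK₀)
  set W₁ : ℝ → CharState d := fun y => charPlus (U 0 (ξ 0 y)) with hW₁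
  set W₂ : ℝ → CharState d := fun y => charMinus (U 0 (ξ 0 y)) with hW₂
  have hm₁ : AEStronglyMeasurable W₁ volume :=
    continuous_charPlus.comp_aestronglyMeasurable hmeas
  have hm₂ : AEStronglyMeasurable W₂ volume :=
    continuous_charMinus.comp_aestronglyMeasurable hmeas
  have hmem := ae_comp_of_ae hK₀ (hV 0)
  have hW₁mem : ∀ᵐ y, W₁ y ∈ ballSlab d (rangePlus α δ) :=
    hmem.mono fun y hy => (mem_setCM_inter_setG_iff.1 hy).1
  have hW₂mem : ∀ᵐ y, W₂ y ∈ ballSlab d (rangeMinus α δ) :=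
    hmem.mono fun y hy => (mem_setCM_inter_setG_iff.1 hy).2
  have hf := primitive_mem_slopeSet (isCompact_ballSlab (isClosed_rangePlus α δ)).isClosed
    (convex_ballSlab (convex_Icc _ _)) norm_le_one_of_mem_ballSlab hm₁ hW₁mem
  have hg := primitive_mem_slopeSet (isCompact_ballSlab (isClosed_rangeMinus α δ)).isClosed
    (convex_ballSlab (convex_Icc _ _)) norm_le_one_of_mem_ballSlab hm₂ hW₂mem
  have hf' : ∀ᵐ y, HasDerivAt (fun x => ∫ s in (0 : ℝ)..x, W₁ s) (W₁ y) y :=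
    (LocallyIntegrable.ae_hasDerivAt_integral (locallyIntegrable_of_ae_bound hm₁
      (hW₁mem.mono fun y hy => norm_le_one_of_mem_ballSlab _ hy))).mono fun y hy => hy 0
  have hg' : ∀ᵐ y, HasDerivAt (fun x => ∫ s in (0 : ℝ)..x, W₂ s) (W₂ y) y :=
    (LocallyIntegrable.ae_hasDerivAt_integral (locallyIntegrable_of_ae_bound hm₂
      (hW₂mem.mono fun y hy => norm_le_one_of_mem_ballSlab _ hy))).mono fun y hy => hy 0
  set f : ℝ → CharState d := fun x => ∫ s in (0 : ℝ)..x, W₁ s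
  set g : ℝ → CharState d := fun x => ∫ s in (0 : ℝ)..x, W₂ s
  have hflow := flow_eq_of_dAlembert hξ.lipschitz hξ.normalized hf.1 hg.1
    (lipschitzWith_of_mem_rightWaves hf) (lipschitzWith_of_mem_leftWaves hg) hf' hg' hξ.dAlembert
  refine ⟨(⟨f, hf⟩, ⟨g, hg⟩), fun t => ?_⟩
  refine ae_of_ae_flow hδ hf hg t ?_
  filter_upwards [hchar t, ae_comp_add hf' t, ae_comp_sub hg' t] with y ⟨h1, h2, h3, h4⟩ h5 h6
  rw [solution_flow hδ hf hg, superpose, h5.deriv, h6.deriv, ← hflow,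
    ← ofChar_charPlus_charMinus (U t (ξ t y))]
  congr 1
  exact Prod.ext (Prod.ext h1 h3) (Prod.ext h2 h4)

theorem transformedSolutions_eq_range {α δ : ℝ} (hδ : 0 < δ) :
    transformedSolutions (setCM d ∩ setG d α δ)
      = range (transformCurve hδ : WavePair d α δ → C(ℝ, LinftyWeakStar d)) := by
  ext u
  constructor
  · rintro ⟨U, hU, hV, hu⟩
    obtain ⟨z, hz⟩ := exists_wavePair hδ hU hV
    exact ⟨z, ((hu.unique (isTransformOf_transformCurve hδ z)) hz).symm⟩
  · rintro ⟨z, rfl⟩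
    exact ⟨_, isGeneralizedSolution_solution hδ z.1.2 z.2.2, valuedIn_solution hδ z.1.2 z.2.2,
      isTransformOf_transformCurve hδ z⟩

/-! ### Density of the relativistic strings -/

theorem floor_div_eq {ε y : ℝ} (hε : 0 < ε) {k : ℤ} (h1 : k * ε ≤ y) (h2 : y < (k + 1) * ε) :
    ⌊y / ε⌋ = k := by
  rw [Int.floor_eq_iff, le_div_iff₀ hε, div_lt_iff₀ hε]
  exact ⟨h1, h2⟩

/-- On each cell `[kε, (k+1)ε]` take `s₁` up to a switching point and `s₂` after it, the point being
chosen to make the mean zero. Only the last incomplete cell contributes to the primitive. -/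
theorem exists_oscillating_selection {s₁ s₂ : ℝ → ℝ} (hm₁ : Measurable s₁) (hm₂ : Measurable s₂)
    {C : ℝ} (hC₁ : ∀ᵐ y, |s₁ y| ≤ C) (hC₂ : ∀ᵐ y, |s₂ y| ≤ C) (h₁ : ∀ᵐ y, 0 ≤ s₁ y)
    (h₂ : ∀ᵐ y, s₂ y ≤ 0) {ε : ℝ} (hε : 0 < ε) :
    ∃ S : ℝ → ℝ, Measurable S ∧ (∀ y, S y = s₁ y ∨ S y = s₂ y) ∧
      ∀ x, |∫ y in (0 : ℝ)..x, S y| ≤ C * ε := by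
  have hi₁ := intervalIntegrable_of_ae_bound hm₁.aestronglyMeasurable hC₁
  have hi₂ := intervalIntegrable_of_ae_bound hm₂.aestronglyMeasurable hC₂
  have hcell : ∀ k : ℤ, ∃ c ∈ Icc ((k : ℝ) * ε) ((k + 1) * ε),
      (∫ y in (k : ℝ) * ε..c, s₁ y) + ∫ y in c..(k + 1) * ε, s₂ y = 0 := by
    intro k
    have hle : (k : ℝ) * ε ≤ (k + 1) * ε := by nlinarith
    have hcont : Continuous fun c => (∫ y in (k : ℝ) * ε..c, s₁ y) + ∫ y in c..(k + 1) * ε, s₂ y := by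
      refine (intervalIntegral.continuous_primitive hi₁ _).add ?_
      refine (intervalIntegral.continuous_primitive hi₂ ((k + 1) * ε)).neg.congr fun c => ?_
      exact (intervalIntegral.integral_symm _ _).symm
    -- The total is nonpositive when `s₂` fills the cell and nonnegative when `s₁` does.
    have := intermediate_value_Icc hle hcont.continuousOn
    refine this ⟨?_, ?_⟩
    · simp only [intervalIntegral.integral_same, zero_add]
      have := intervalIntegral.integral_nonneg_of_ae hle (f := fun y => -s₂ y) (μ := volume)
        (h₂.mono fun y hy => neg_nonneg.2 hy)
      rw [intervalIntegral.integral_neg] at this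
      linarith
    · simp only [intervalIntegral.integral_same, add_zero]
      exact intervalIntegral.integral_nonneg_of_ae hle h₁
  choose c hc hc0 using hcell
  set S : ℝ → ℝ := fun y => if y ≤ c ⌊y / ε⌋ then s₁ y else s₂ y with hS
  have hSm : Measurable S := by
    refine Measurable.ite (measurableSet_le measurable_id ?_) hm₁ hm₂
    exact (measurable_from_top (f := c)).comp
      (Int.measurable_floor.comp (measurable_id.div_const ε))
  have hsel : ∀ y, S y = s₁ y ∨ S y = s₂ y := fun y => by
    by_cases h : y ≤ c ⌊y / ε⌋
    · left; simp [hS, h]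
    · right; simp [hS, h]
  have hCS : ∀ᵐ y, ‖S y‖ ≤ C := by
    filter_upwards [hC₁, hC₂] with y h1 h2
    rcases hsel y with h | h <;> rw [h, Real.norm_eq_abs] <;> assumption
  have hiS := intervalIntegrable_of_ae_bound hSm.aestronglyMeasurable hCS
  have hzero : ∀ k : ℤ, ∫ y in (k : ℝ) * ε..(k + 1) * ε, S y = 0 := by
    intro k
    -- At the right endpoint the floor already designates the next cell.
    have hne : ∀ᵐ y : ℝ, y ≠ (k + 1) * ε := by simp [ae_iff]
    rw [← intervalIntegral.integral_add_adjacent_intervals (hiS _ (c k)) (hiS _ _), ← hc0 k]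
    congr 1
    · refine intervalIntegral.integral_congr_ae ?_
      filter_upwards [hne] with y hy hmem
      rw [uIoc_of_le (hc k).1] at hmem
      have hk := floor_div_eq hε hmem.1.le (lt_of_le_of_ne (hmem.2.trans (hc k).2) hy)
      simp [hS, hk, hmem.2]
    · refine intervalIntegral.integral_congr_ae ?_
      filter_upwards [hne] with y hy hmem
      rw [uIoc_of_le (hc k).2] at hmem
      have hk := floor_div_eq hε ((hc k).1.trans hmem.1.le) (lt_of_le_of_ne hmem.2 hy)
      simp [hS, hk, not_le.2 hmem.1]
  have hnodes : ∀ k : ℤ, ∫ y in (0 : ℝ)..k * ε, S y = 0 := by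
    intro k
    induction k using Int.induction_on with
    | zero => simp
    | succ n ih =>
      have h := hzero n
      push_cast at ih h ⊢
      rw [← intervalIntegral.integral_add_adjacent_intervals (hiS _ (n * ε)) (hiS _ _), ih, h,
        add_zero]
    | pred n ih =>
      have h := hzero (-n - 1)
      push_cast at ih h ⊢
      rw [sub_add_cancel] at h
      rw [← intervalIntegral.integral_add_adjacent_intervals (hiS _ (-n * ε)) (hiS _ _), ih,
        intervalIntegral.integral_symm, h, neg_zero, add_zero]
  refine ⟨S, hSm, hsel, fun x => ?_⟩
  have hC0 : 0 ≤ C := by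
    obtain ⟨y, hy⟩ := hC₁.exists
    exact (abs_nonneg _).trans hy
  rw [← intervalIntegral.integral_add_adjacent_intervals (hiS 0 (⌊x / ε⌋ * ε)) (hiS _ x),
    hnodes, zero_add, ← Real.norm_eq_abs]
  refine (intervalIntegral.norm_integral_le_of_norm_le_const_ae
    (hCS.mono fun y hy _ => hy)).trans ?_
  have h1 := (le_div_iff₀ hε).1 (Int.floor_le (x / ε))
  have h2 := (div_lt_iff₀ hε).1 (Int.lt_floor_add_one (x / ε))
  gcongr
  rw [abs_le]
  constructor <;> linarith

theorem exists_sphere_endpoints (hd : 1 ≤ d) {W : ℝ → CharState d} (hW : Measurable W)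
    {I : Set ℝ} (hI : ∀ᵐ y, W y ∈ ballSlab d I) :
    ∃ (e : EuclideanSpace ℝ (Fin d)) (s₁ s₂ : ℝ → ℝ), ‖e‖ = 1 ∧ Measurable s₁ ∧ Measurable s₂ ∧
      ∀ᵐ y, |s₁ y| ≤ 2 ∧ |s₂ y| ≤ 2 ∧ 0 ≤ s₁ y ∧ s₂ y ≤ 0 ∧
        W y + s₁ y • (0, e) ∈ sphereSlab d I ∧ W y + s₂ y • (0, e) ∈ sphereSlab d I := by
  set e : EuclideanSpace ℝ (Fin d) := EuclideanSpace.single ⟨0, hd⟩ 1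
  have he : ‖e‖ = 1 := by simp [e]
  set b : ℝ → ℝ := fun y => ⟪(W y).2, e⟫_ℝ
  -- The equation `|W + s (0, e)|² = 1` reads `(s + b)² = r²`, with roots `-b ± r`. Inside the ball
  -- `|b| ≤ r ≤ 1`, which gives their signs and the bound `2`.
  set r : ℝ → ℝ := fun y => √(b y ^ 2 + (1 - (W y).1 ^ 2 - ‖(W y).2‖ ^ 2))
  have hb : Measurable b := hW.snd.inner measurable_const
  have hr : Measurable r :=
    ((hb.pow_const 2).add ((measurable_const.sub (hW.fst.pow_const 2)).sub
      (hW.snd.norm.pow_const 2))).sqrt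
  refine ⟨e, fun y => -b y + r y, fun y => -b y - r y, he, hb.neg.add hr, hb.neg.sub hr, ?_⟩
  filter_upwards [hI] with y ⟨hyI, hy⟩
  have hcs : |b y| ≤ ‖(W y).2‖ := by simpa [he] using abs_real_inner_le_norm (W y).2 e
  have hcs2 : b y ^ 2 ≤ ‖(W y).2‖ ^ 2 := sq_le_sq' (by linarith [neg_abs_le (b y)])
    ((le_abs_self _).trans hcs)
  have hr0 : 0 ≤ r y := Real.sqrt_nonneg _
  have hr2 : r y ^ 2 = b y ^ 2 + (1 - (W y).1 ^ 2 - ‖(W y).2‖ ^ 2) :=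
    Real.sq_sqrt (by nlinarith [sq_nonneg (b y)])
  have hrb : |b y| ≤ r y := Real.abs_le_sqrt (by linarith)
  have hr1 : r y ≤ 1 := Real.sqrt_le_one.2 (by nlinarith [sq_nonneg (W y).1])
  have hsph : ∀ s : ℝ, (s + b y) ^ 2 = r y ^ 2 → W y + s • ((0, e) : CharState d) ∈
      sphereSlab d I := by
    intro s hs
    refine ⟨by simpa using hyI, ?_⟩
    simp only [Prod.fst_add, Prod.snd_add, Prod.smul_fst, Prod.smul_snd, smul_zero, add_zero]
    rw [norm_add_sq_real, inner_smul_right, norm_smul, he, mul_one, Real.norm_eq_abs, sq_abs]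
    change _ + (_ + 2 * (s * b y) + _) = _
    nlinarith
  have hb1 := abs_le.1 hrb
  refine ⟨abs_le.2 ⟨by linarith, by linarith⟩, abs_le.2 ⟨by linarith, by linarith⟩, by linarith,
    by linarith, hsph _ (by ring), hsph _ (by ring)⟩

theorem exists_tendsto_of_sphereSlab (hd : 1 ≤ d) {I : Set ℝ} (hI : IsClosed I)
    (hconv : Convex ℝ I) {f : ℝ → CharState d} (hf : f ∈ slopeSet (ballSlab d I)) :
    ∃ F : ℕ → ℝ → CharState d, (∀ n, F n ∈ slopeSet (ballSlab d I)) ∧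
      (∀ n, ∀ᵐ y, deriv (F n) y ∈ sphereSlab d I) ∧ Tendsto F atTop (𝓝 f) := by
  have hlip := lipschitzWith_of_mem_slopeSet norm_le_one_of_mem_ballSlab hf
  have hmem := ae_deriv_mem_of_mem_slopeSet hI hf
  have hbound : ∀ᵐ y, ‖deriv f y‖ ≤ 1 := hmem.mono fun y hy => norm_le_one_of_mem_ballSlab _ hy
  obtain ⟨e, s₁, s₂, he, hm₁, hm₂, hs⟩ := exists_sphere_endpoints hd (measurable_deriv f) hmem
  have hsel := fun n : ℕ => exists_oscillating_selection hm₁ hm₂ (hs.mono fun y h => h.1)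
    (hs.mono fun y h => h.2.1) (hs.mono fun y h => h.2.2.1) (hs.mono fun y h => h.2.2.2.1)
    (Nat.one_div_pos_of_nat (α := ℝ) (n := n))
  choose S hSm hSsel hSint using hsel
  set E : CharState d := (0, e)
  have hWm : ∀ n, AEStronglyMeasurable (fun y => deriv f y + S n y • E) volume := fun n =>
    ((measurable_deriv f).add ((hSm n).smul_const E)).aestronglyMeasurable
  have hWmem : ∀ n, ∀ᵐ y, deriv f y + S n y • E ∈ sphereSlab d I := by
    intro n
    filter_upwards [hs] with y hy
    rcases hSsel n y with h | h <;> rw [h]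
    exacts [hy.2.2.2.2.1, hy.2.2.2.2.2]
  have hWball : ∀ n, ∀ᵐ y, deriv f y + S n y • E ∈ ballSlab d I := fun n =>
    (hWmem n).mono fun y hy => sphereSlab_subset_ballSlab I hy
  have hSb : ∀ n, ∀ᵐ y, ‖S n y‖ ≤ 2 := by
    intro n
    filter_upwards [hs] with y hy
    rcases hSsel n y with h | h <;> rw [h, Real.norm_eq_abs]
    exacts [hy.1, hy.2.1]
  refine ⟨fun n x => ∫ y in (0 : ℝ)..x, (deriv f y + S n y • E), fun n => ?_, fun n => ?_, ?_⟩
  · exact primitive_mem_slopeSet (isCompact_ballSlab hI).isClosed (convex_ballSlab hconv)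
      norm_le_one_of_mem_ballSlab (hWm n) (hWball n)
  · filter_upwards [hWmem n, LocallyIntegrable.ae_hasDerivAt_integral
      (locallyIntegrable_of_ae_bound (hWm n)
        ((hWball n).mono fun y hy => norm_le_one_of_mem_ballSlab _ hy))] with y h1 h2
    rwa [(h2 0).deriv]
  · refine tendsto_pi_nhds.2 fun x => ?_
    have hF : ∀ n, ∫ y in (0 : ℝ)..x, (deriv f y + S n y • E)
        = f x + (∫ y in (0 : ℝ)..x, S n y) • E := by
      intro n
      have hi := intervalIntegrable_of_ae_bound (hSm n).aestronglyMeasurable (hSb n) 0 x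
      rw [intervalIntegral.integral_add (intervalIntegrable_of_ae_bound
        (measurable_deriv f).aestronglyMeasurable hbound _ _) 
        ⟨hi.1.smul_const E, hi.2.smul_const E⟩,
        intervalIntegral.integral_smul_const, integral_eq_sub_of_ae_hasDerivAt hlip
        (measurable_deriv f).aestronglyMeasurable hbound (ae_hasDerivAt_of_lipschitzWith hlip),
        hf.1, sub_zero]
    simp only [hF]
    have h0 : Tendsto (fun n => ∫ y in (0 : ℝ)..x, S n y) atTop (𝓝 0) := by
      refine squeeze_zero_norm (fun n => hSint n x) ?_
      simpa using tendsto_one_div_add_atTop_nhds_zero_nat.const_mul (2 : ℝ)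
    simpa using (h0.smul_const E).const_add (f x)

theorem transformCurve_mem_closure (hd : 1 ≤ d) {α δ : ℝ} (hδ : 0 < δ) (z : WavePair d α δ) :
    transformCurve hδ z ∈ closure (transformedSolutions (setM d ∩ setG d α δ)) := by
  obtain ⟨⟨f, hf⟩, g, hg⟩ := z
  obtain ⟨F, hF, hF', hFlim⟩ :=
    exists_tendsto_of_sphereSlab hd (isClosed_rangePlus α δ) (convex_Icc _ _) hf
  obtain ⟨G, hG, hG', hGlim⟩ :=
    exists_tendsto_of_sphereSlab hd (isClosed_rangeMinus α δ) (convex_Icc _ _) hg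
  have hlim : Tendsto (fun n => ((⟨F n, hF n⟩, ⟨G n, hG n⟩) : WavePair d α δ)) atTop
      (𝓝 (⟨f, hf⟩, ⟨g, hg⟩)) :=
    (tendsto_subtype_rng.2 hFlim).prodMk_nhds (tendsto_subtype_rng.2 hGlim)
  refine mem_closure_of_tendsto (((continuous_transformCurve hδ).tendsto _).comp hlim)
    (Eventually.of_forall fun n => ?_)
  exact ⟨_, isGeneralizedSolution_solution hδ (hF n) (hG n),
    valuedIn_solution_of_sphere hδ (hF n) (hG n) (hF' n) (hG' n),
    isTransformOf_transformCurve hδ _⟩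

theorem transformedSolutions_mono {S S' : Set (State d)} (h : S ⊆ S') :
    transformedSolutions S ⊆ transformedSolutions S' :=
  fun _ ⟨U, hU, hV, hu⟩ => ⟨U, hU, fun t => (hV t).mono fun _ hs => h hs, hu⟩

end RelString

end

theorem theorem4 (d : ℕ) (hd : 1 ≤ d) (α δ : ℝ) (hδ₀ : 0 < δ) (hδ₁ : δ < 1) :
    (∀ U : ℝ → ℝ → RelString.State d, RelString.IsGeneralizedSolution U →
      RelString.ValuedIn U (RelString.setCM d ∩ RelString.setG d α δ) →
      ∃! u : C(ℝ, RelString.LinftyWeakStar d), RelString.IsTransformOf u U) ∧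
    IsCompact (closure (RelString.transformedSolutions
      (RelString.setM d ∩ RelString.setG d α δ))) ∧
    closure (RelString.transformedSolutions (RelString.setM d ∩ RelString.setG d α δ)) =
      RelString.transformedSolutions (RelString.setCM d ∩ RelString.setG d α δ) := by
  -- Compactness also yields closedness, since the weak-* topology is Hausdorff; one inclusion of
  -- the closure identity follows.
  have hcompact : IsCompact (RelString.transformedSolutions
      (RelString.setCM d ∩ RelString.setG d α δ)) := by
    rw [RelString.transformedSolutions_eq_range hδ₀]
    exact isCompact_range (RelString.continuous_transformCurve hδ₀)
  have hclosure : closure (RelString.transformedSolutions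
      (RelString.setM d ∩ RelString.setG d α δ)) =
      RelString.transformedSolutions (RelString.setCM d ∩ RelString.setG d α δ) := by
    refine (closure_minimal (RelString.transformedSolutions_mono
      (RelString.setM_inter_setG_subset α δ)) hcompact.isClosed).antisymm ?_
    rw [RelString.transformedSolutions_eq_range hδ₀]
    rintro _ ⟨z, rfl⟩
    exact RelString.transformCurve_mem_closure hd hδ₀ z
  refine ⟨fun U hU hV => ?_, hclosure ▸ hcompact, hclosure⟩
  obtain ⟨z, hz⟩ := RelString.exists_wavePair hδ₀ hU hV
  refine ⟨RelString.transformCurve hδ₀ z, fun t => ?_, fun u hu =>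
    hu.unique (RelString.isTransformOf_transformCurve hδ₀ z) hz⟩
  filter_upwards [RelString.isTransformOf_transformCurve hδ₀ z t, hz t] with s h1 h2
  rw [h1, h2]
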